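/- All Banach spaces are real. A metric space $(M,d)$ is *stable* if $\lim_{i,\mathcal U}\lim_{j,\mathcal V} d(x_i,y_j)=\lim_{j,\mathcal V}\lim_{i,\mathcal U} d(x_i,y_j)$ for all bounded sequences $(x_i)$, $(y_j)$ in $M$ and all nonprincipal ultrafilters $\mathcal U,\mathcal V$ on $\mathbb N$. A Banach space $W$ is *finitely representable* in a Banach space $Y$ if for every finite-dimensional subspace $E\subseteq W$ and every $\varepsilon>0$ there are a subspace $F\subseteq Y$ and a linear isomorphism $T\colon E\to F$ with $\|T\|\,\|T^{-1}\|<1+\varepsilon$; $Y$ is *superstable* if every Banach space that is finitely representable in $Y$ is stable (in the metric of its norm). A map $f\colon X\to Y$ between Banach spaces is *almost uncollapsed* if there is $t>0$ with $\inf\{\|f(x)-f(y)\| : x,y\in X,\ \|x-y\|=t\}>0$ (where $\inf\emptyset=\infty$). A map between metric spaces is a *uniform embedding* if it is injective and uniformly continuous and its inverse, defined on its image, is uniformly continuous. **Theorem.** Let $X$ be a Banach space, let $Y$ be a superstable Banach space, and suppose that there is a map $f\colon X\to Y$ that is both uniformly continuous and almost uncollapsed. Then the closed unit ball $B_X$ of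 $X$ uniformly embeds into a superstable Banach space. In fact, there are a superstable Banach space $Z$ and a uniformly continuous map $F\colon X\to Z$ such that the restriction $F|_{B_X}$ is a uniform embedding whose inverse $F(B_X)\to B_X$ is Lipschitz, i.e. for some constant $K\ge 0$ one has $\|x-y\|\le K\|F(x)-F(y)\|$ for all $x,y\in B_X$. -/

import Mathlib

open Filter Topology
open scoped ENNReal

universe u v w

/-- A metric space `M` is stable if
`lim_{i,U} lim_{j,V} d (x i, y j) = lim_{j,V} lim_{i,U} d (x i, y j)` for all bounded sequences
`x`, `y` in `M` and all nonprincipal ultrafilters `U`, `V` on `ℕ`. All the limits exist, because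
the sequences are bounded; here `g i` and `a` are the inner and the outer limit of the left-hand
side, and `h j` and `b` those of the right-hand side. -/
def IsStableSpace (M : Type u) [MetricSpace M] : Prop :=
  ∀ x y : ℕ → M, Bornology.IsBounded (Set.range x) → Bornology.IsBounded (Set.range y) →
    ∀ U V : Ultrafilter ℕ, (∀ n : ℕ, U ≠ pure n) → (∀ n : ℕ, V ≠ pure n) →
      ∀ (g h : ℕ → ℝ) (a b : ℝ),
        (∀ i, Tendsto (fun j => dist (x i) (y j)) V (𝓝 (g i))) → Tendsto g U (𝓝 a) →
        (∀ j, Tendsto (fun i => dist (x i) (y j)) U (𝓝 (h j))) → Tendsto h V (𝓝 b) →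
        a = b

/-- `W` is finitely representable in `Y`: for every finite-dimensional subspace `E` of `W` and
every `ε > 0` there are a subspace `F` of `Y` and a linear isomorphism `T` of `E` onto `F` with
`‖T‖ * ‖T⁻¹‖ < 1 + ε`. -/
def IsFinitelyRepresentable (W : Type w) [NormedAddCommGroup W] [NormedSpace ℝ W]
    (Y : Type v) [NormedAddCommGroup Y] [NormedSpace ℝ Y] : Prop :=
  ∀ E : Submodule ℝ W, FiniteDimensional ℝ E → ∀ ε : ℝ, 0 < ε →
    ∃ (F : Submodule ℝ Y) (T : E ≃L[ℝ] F),
      ‖(T : E →L[ℝ] F)‖ * ‖(T.symm : F →L[ℝ] E)‖ < 1 + ε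

/-- `Y` is superstable: every Banach space `W` that is finitely representable in `Y` is stable.
The universe `w` of the spaces `W` does not matter: stability concerns the separable subspaces
of `W` only, and those have copies in every universe. -/
def IsSuperstable (Y : Type v) [NormedAddCommGroup Y] [NormedSpace ℝ Y] : Prop :=
  ∀ (W : Type w) [NormedAddCommGroup W] [NormedSpace ℝ W] [CompleteSpace W],
    IsFinitelyRepresentable W Y → IsStableSpace W

/-- The exact compression modulus `inf {‖f x - f y‖ : ‖x - y‖ = t}`, as an extended nonnegative
real number; the infimum of the empty set is `∞`. -/
noncomputable def exactCompressionModulus {X : Type u} {Y : Type v}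
    [NormedAddCommGroup X] [NormedAddCommGroup Y] (f : X → Y) (t : ℝ) : ℝ≥0∞ :=
  ⨅ (x : X) (y : X) (_ : ‖x - y‖ = t), ENNReal.ofReal ‖f x - f y‖

/-- `f` is almost uncollapsed: its exact compression modulus is positive at some `t > 0`. -/
def IsAlmostUncollapsed {X : Type u} {Y : Type v}
    [NormedAddCommGroup X] [NormedAddCommGroup Y] (f : X → Y) : Prop :=
  ∃ t : ℝ, 0 < t ∧ 0 < exactCompressionModulus f t

/-! The embedding averages `f` over translations. An abelian group carries an invariant mean.
Seminorm the bounded functions from `X` to `Y` by the mean of `‖g z‖`, and send `x` to `z ↦ f (x +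
z) - f z`. This map inherits uniform continuity, and by invariance the distance of two images
depends only on the difference of the points. So `n` equal steps move at most `n` times as far as
one step. About `t / ‖x - y‖` steps of size `‖x - y‖` reach a distance near `t`, where `f` separates
points uniformly; hence a single step moves at least a fixed multiple of `‖x - y‖`
(`le_norm_translateMap_sub`).

The difficulty is the superstability of the function space. It is expressed by inequalities that are
linear in norms, and these survive averaging. `DefectBound` says that signed triangle defects,
summed along the branches of a binary tree and charged `η` times the norms involved, have
nonpositive mean. Such a bound integrates against every mean (`MeanSpace.defectBound`). It also
forbids long ladders, because binary search turns a ladder into a tree with positive mean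
(`DefectBound.not_hasNormLadder`). Instability produces arbitrarily long ladders, which are finite
configurations and pass through finite representability and completion. So bounds for all `η > 0`
give superstability (`isSuperstable_completion_meanSpace`).

Superstability of `Y` yields the bounds. Ultrapowers of `Y` are finitely representable in `Y`, hence
stable, and a Ramsey argument for trees then bounds the depth to which defects can shatter the unit
shell (`IsSuperstable.exists_not_shatters`). As in online learning, a bounded depth tames sums along
branches: at each query, the leaf labels outside two sets of smaller rank have nearly the same
defect, which the random sign cancels. Exponential moments therefore grow only polynomially
(`pathAvg_exp_le`), while the penalties decay exponentially. Homogeneity and a sum over dyadic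
scales remove the restriction to the shell (`exists_defectBound`). -/

/-! ### Sums along the branches of binary trees -/

/-- The average of `Ψ` over all lists of `n` signs. -/
noncomputable def pathAvg : ℕ → (List Bool → ℝ) → ℝ
  | 0, Ψ => Ψ []
  | n + 1, Ψ => (pathAvg n (fun l => Ψ (false :: l)) + pathAvg n (fun l => Ψ (true :: l))) / 2

/-- The sum of the costs `c` along a path in the binary tree with node labels `b`, where the label
of a node depends on the signs that lead to it. -/
def pathSum {A B : Type*} (c : Bool → A → B → ℝ) : (List Bool → B) → A → List Bool → ℝ
  | _, _, [] => 0
  | b, x, e :: l => c e x (b []) + pathSum c (fun k => b (e :: k)) x l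

theorem pathAvg_mono {n : ℕ} {Ψ Ψ' : List Bool → ℝ} (h : ∀ l, l.length = n → Ψ l ≤ Ψ' l) :
    pathAvg n Ψ ≤ pathAvg n Ψ' := by
  induction n generalizing Ψ Ψ' with
  | zero => exact h [] rfl
  | succ n ih =>
    have h1 := ih (Ψ := fun l => Ψ (false :: l)) (Ψ' := fun l => Ψ' (false :: l))
      (fun l hl => h _ (by simp [hl]))
    have h2 := ih (Ψ := fun l => Ψ (true :: l)) (Ψ' := fun l => Ψ' (true :: l))
      (fun l hl => h _ (by simp [hl]))
    simp only [pathAvg]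
    linarith

theorem pathAvg_const (n : ℕ) (a : ℝ) : pathAvg n (fun _ => a) = a := by
  induction n with
  | zero => rfl
  | succ n ih => simp only [pathAvg, ih]; ring

theorem pathAvg_add (n : ℕ) (Ψ Ψ' : List Bool → ℝ) :
    pathAvg n (fun l => Ψ l + Ψ' l) = pathAvg n Ψ + pathAvg n Ψ' := by
  induction n generalizing Ψ Ψ' with
  | zero => rfl
  | succ n ih => simp only [pathAvg, ih]; ring

theorem pathAvg_mul (n : ℕ) (a : ℝ) (Ψ : List Bool → ℝ) :
    pathAvg n (fun l => a * Ψ l) = a * pathAvg n Ψ := by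
  induction n generalizing Ψ with
  | zero => rfl
  | succ n ih => simp only [pathAvg, ih]; ring

theorem pathAvg_sum {ι : Type*} (n : ℕ) (s : Finset ι) (Ψ : ι → List Bool → ℝ) :
    pathAvg n (fun l => ∑ k ∈ s, Ψ k l) = ∑ k ∈ s, pathAvg n (Ψ k) := by
  classical
  induction s using Finset.induction_on with
  | empty => simp [pathAvg_const]
  | insert a s ha ih => simp only [Finset.sum_insert ha, pathAvg_add, ih]

theorem pathAvg_le {n : ℕ} {Ψ : List Bool → ℝ} {a : ℝ} (h : ∀ l, l.length = n → Ψ l ≤ a) :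
    pathAvg n Ψ ≤ a :=
  (pathAvg_mono h).trans_eq (pathAvg_const n a)

theorem le_pathAvg {n : ℕ} {Ψ : List Bool → ℝ} {a : ℝ} (h : ∀ l, l.length = n → a ≤ Ψ l) :
    a ≤ pathAvg n Ψ :=
  (pathAvg_const n a).symm.trans_le (pathAvg_mono h)

section PathSum

variable {A B : Type*}

theorem pathSum_mono {c c' : Bool → A → B → ℝ} {x : A} (h : ∀ e y, c e x y ≤ c' e x y)
    (b : List Bool → B) (l : List Bool) : pathSum c b x l ≤ pathSum c' b x l := by
  induction l generalizing b with
  | nil => exact le_rfl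
  | cons e l ih => exact add_le_add (h _ _) (ih _)

theorem pathSum_nonneg {c : Bool → A → B → ℝ} {x : A} (h : ∀ e y, 0 ≤ c e x y)
    (b : List Bool → B) (l : List Bool) : 0 ≤ pathSum c b x l := by
  induction l generalizing b with
  | nil => exact le_rfl
  | cons e l ih => exact add_nonneg (h _ _) (ih _)

theorem pathSum_add (c c' : Bool → A → B → ℝ) (b : List Bool → B) (x : A) (l : List Bool) :
    pathSum (fun e x y => c e x y + c' e x y) b x l = pathSum c b x l + pathSum c' b x l := by
  induction l generalizing b with
  | nil => simp [pathSum]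
  | cons e l ih => simp only [pathSum, ih]; ring

theorem pathSum_mul (a : ℝ) (c : Bool → A → B → ℝ) (b : List Bool → B) (x : A) (l : List Bool) :
    pathSum (fun e x y => a * c e x y) b x l = a * pathSum c b x l := by
  induction l generalizing b with
  | nil => simp [pathSum]
  | cons e l ih => simp only [pathSum, ih]; ring

theorem pathSum_sum {ι : Type*} (s : Finset ι) (c : ι → Bool → A → B → ℝ) (b : List Bool → B)
    (x : A) (l : List Bool) :
    pathSum (fun e x y => ∑ k ∈ s, c k e x y) b x l = ∑ k ∈ s, pathSum (c k) b x l := by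
  induction l generalizing b with
  | nil => simp [pathSum]
  | cons e l ih => simp only [pathSum, ih, Finset.sum_add_distrib]

theorem pathSum_left (g : A → ℝ) (b : List Bool → B) (x : A) (l : List Bool) :
    pathSum (fun _ x _ => g x) b x l = l.length * g x := by
  induction l generalizing b with
  | nil => simp [pathSum]
  | cons e l ih => simp only [pathSum, ih, List.length_cons]; push_cast; ring

end PathSum

/-- The sign `1` or `-1` that belongs to a Boolean. -/
def boolSign (e : Bool) : ℝ := if e then 1 else -1

@[simp] theorem boolSign_true : boolSign true = 1 := rfl
@[simp] theorem boolSign_false : boolSign false = -1 := rfl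

theorem boolSign_mul_le_abs (e : Bool) (a : ℝ) : boolSign e * a ≤ |a| := by
  cases e <;> simp [le_abs_self, neg_le_abs]

/-- Signed sums of predictable quantities have mean zero. -/
theorem pathAvg_pathSum_boolSign {A B : Type*} (n : ℕ) (g : B → ℝ) (b : List Bool → B)
    (x : List Bool → A) :
    pathAvg n (fun l => pathSum (fun e _ y => boolSign e * g y) b (x l) l) = 0 := by
  induction n generalizing b x with
  | zero => rfl
  | succ n ih =>
    simp only [pathAvg, pathSum, pathAvg_add, pathAvg_const]
    rw [ih (fun k => b (false :: k)) (fun k => x (false :: k)),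
      ih (fun k => b (true :: k)) (fun k => x (true :: k))]
    simp

/-- Binary search in a ladder: costs that dominate `d` on the pairs in the right order
dominate `d` along a tree labelled by entries of the ladder. -/
theorem exists_tree_of_ladder {A B : Type*} (n : ℕ) (x : ℕ → A) (y : ℕ → B)
    (c d : Bool → A → B → ℝ) (lo : ℕ)
    (h : ∀ i j, lo ≤ i → i < lo + 2 ^ n → lo ≤ j → j < lo + 2 ^ n →
      (j ≤ i → d true (x i) (y j) ≤ c true (x i) (y j)) ∧
      (i < j → d false (x i) (y j) ≤ c false (x i) (y j))) :
    ∃ (b : List Bool → B) (k : List Bool → ℕ), (∀ l, lo ≤ k l ∧ k l < lo + 2 ^ n) ∧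
      ∀ l, l.length = n → pathSum d b (x (k l)) l ≤ pathSum c b (x (k l)) l := by
  induction n generalizing lo with
  | zero =>
    -- A tree of depth zero has no nodes, so the label `y 0` is a dummy.
    refine ⟨fun _ => y 0, fun _ => lo, fun l => by simp, fun l hl => ?_⟩
    rw [List.length_eq_zero_iff.1 hl]
    exact le_rfl
  | succ n ih =>
    have hp : 2 ^ (n + 1) = 2 ^ n + 2 ^ n := by ring
    have hpos : 0 < 2 ^ n := by positivity
    obtain ⟨b₀, k₀, hk₀, h₀⟩ := ih lo
      (fun i j h1 h2 h3 h4 => h i j h1 (by omega) h3 (by omega))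
    obtain ⟨b₁, k₁, hk₁, h₁⟩ := ih (lo + 2 ^ n)
      (fun i j h1 h2 h3 h4 => h i j (by omega) (by omega) (by omega) (by omega))
    -- The root asks whether the index lies in the upper half, whose first entry is the root label.
    -- That entry itself belongs to the branch `true`, which matches `j ≤ i`.
    refine ⟨fun l => match l with
        | [] => y (lo + 2 ^ n)
        | false :: l => b₀ l
        | true :: l => b₁ l,
      fun l => match l with
        | [] => lo
        | false :: l => k₀ l
        | true :: l => k₁ l, ?_, ?_⟩
    · rintro (_ | ⟨_ | _, l⟩)
      · simp
      · have := hk₀ l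
        simp only
        omega
      · have := hk₁ l
        simp only
        omega
    · rintro (_ | ⟨_ | _, l⟩) hl
      · simp at hl
      · have hl' : l.length = n := by simpa using hl
        have hk := hk₀ l
        exact add_le_add ((h _ _ hk.1 (by omega) (by omega) (by omega)).2 (by omega)) (h₀ l hl')
      · have hl' : l.length = n := by simpa using hl
        have hk := hk₁ l
        exact add_le_add ((h (k₁ l) _ (by omega) (by omega) (by omega) (by omega)).1 (by omega))
          (h₁ l hl')

/-! ### Shattering, tree Ramsey theory and ladders -/

/-- The sets of points `G` that are shattered to depth `n` by a binary tree of queries in `H`. -/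
def Shatters {A P : Type*} (low high : P → Set A) : ℕ → Set A → Set P → Prop
  | 0, G, _ => G.Nonempty
  | n + 1, G, H => ∃ p ∈ H, Shatters low high n (G ∩ low p) H ∧ Shatters low high n (G ∩ high p) H

namespace Shatters

variable {A P : Type*} {low high : P → Set A}

theorem mono {n : ℕ} {G G' : Set A} {H H' : Set P} (h : Shatters low high n G H) (hG : G ⊆ G')
    (hH : H ⊆ H') : Shatters low high n G' H' := by
  induction n generalizing G G' with
  | zero => exact Set.Nonempty.mono hG h
  | succ n ih =>
    obtain ⟨p, hp, h1, h2⟩ := h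
    exact ⟨p, hH hp, ih h1 (Set.inter_subset_inter_left _ hG),
      ih h2 (Set.inter_subset_inter_left _ hG)⟩

theorem nonempty {n : ℕ} {G : Set A} {H : Set P} (h : Shatters low high n G H) : G.Nonempty := by
  induction n generalizing G with
  | zero => exact h
  | succ n ih =>
    obtain ⟨p, hp, h1, h2⟩ := h
    exact (ih h1).mono Set.inter_subset_left

/-- The Ramsey property of binary trees whose nodes have two colours. -/
theorem of_union {m n : ℕ} {G : Set A} {H H' : Set P}
    (h : Shatters low high (m + n) G (H ∪ H')) :
    Shatters low high m G H ∨ Shatters low high n G H' := by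
  induction hk : m + n generalizing m n G with
  | zero =>
    obtain ⟨rfl, rfl⟩ : m = 0 ∧ n = 0 := by omega
    exact Or.inl h.nonempty
  | succ k ih =>
    rcases m with _ | m
    · exact Or.inl h.nonempty
    rcases n with _ | n
    · exact Or.inr h.nonempty
    rw [hk] at h
    obtain ⟨p, hp, h1, h2⟩ := h
    have key : ∀ {m' n' : ℕ}, m' + n' = k → ∀ G' ⊆ G, Shatters low high k G' (H ∪ H') →
        Shatters low high m' G' H ∨ Shatters low high n' G' H' := by
      intro m' n' hmn G' _ hs
      exact ih (by rwa [hmn]) hmn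
    -- The colour of the root decides which depth may drop by one below it. Either both subtrees are
    -- deep in that colour and the root joins them, or one subtree is deep enough in the other
    -- colour.
    rcases hp with hp | hp
    · have e : m + (n + 1) = k := by omega
      rcases key e _ Set.inter_subset_left h1 with a1 | a1
      · rcases key e _ Set.inter_subset_left h2 with a2 | a2
        · exact Or.inl ⟨p, hp, a1, a2⟩
        · exact Or.inr (a2.mono Set.inter_subset_left le_rfl)
      · exact Or.inr (a1.mono Set.inter_subset_left le_rfl)
    · have e : (m + 1) + n = k := by omega
      rcases key e _ Set.inter_subset_left h1 with a1 | a1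
      · exact Or.inl (a1.mono Set.inter_subset_left le_rfl)
      · rcases key e _ Set.inter_subset_left h2 with a2 | a2
        · exact Or.inl (a2.mono Set.inter_subset_left le_rfl)
        · exact Or.inr ⟨p, hp, a1, a2⟩

end Shatters

/-- A ladder of length `n` in `G` and `H`: the relation `S` holds on and above the diagonal and the
relation `R` below it. -/
def HasLadder {A P : Type*} (S R : P → Set A) (n : ℕ) (G : Set A) (H : Set P) : Prop :=
  ∃ (x : ℕ → A) (p : ℕ → P), (∀ i < n, x i ∈ G ∧ p i ∈ H) ∧
    ∀ i < n, ∀ j < n, (i ≤ j → x i ∈ S (p j)) ∧ (j < i → x i ∈ R (p j))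

namespace HasLadder

variable {A P : Type*} {S R : P → Set A}

theorem mono {n m : ℕ} {G G' : Set A} {H H' : Set P} (h : HasLadder S R n G H) (hm : m ≤ n)
    (hG : G ⊆ G') (hH : H ⊆ H') : HasLadder S R m G' H' := by
  obtain ⟨x, p, h1, h2⟩ := h
  exact ⟨x, p, fun i hi => ⟨hG (h1 i (by omega)).1, hH (h1 i (by omega)).2⟩,
    fun i hi j hj => h2 i (by omega) j (by omega)⟩

theorem zero [Nonempty A] [Nonempty P] (G : Set A) (H : Set P) : HasLadder S R 0 G H :=
  ⟨fun _ => Classical.arbitrary A, fun _ => Classical.arbitrary P, by simp, by simp⟩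

/-- A new first rung: all later points must lie in `R p`, and all later queries must contain `x` in
their `S`-set. -/
theorem cons {n : ℕ} {G : Set A} {H : Set P} {x : A} {p : P} (hx : x ∈ G) (hp : p ∈ H)
    (hxp : x ∈ S p) (h : HasLadder S R n (G ∩ R p) (H ∩ {q | x ∈ S q})) :
    HasLadder S R (n + 1) G H := by
  obtain ⟨X, Q, h1, h2⟩ := h
  refine ⟨fun n => Nat.casesOn n x X, fun n => Nat.casesOn n p Q, ?_, ?_⟩
  · rintro (_ | i) hi
    · exact ⟨hx, hp⟩
    · exact ⟨(h1 i (by omega)).1.1, (h1 i (by omega)).2.1⟩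
  · rintro (_ | i) hi (_ | j) hj
    · exact ⟨fun _ => hxp, fun h => absurd h (lt_irrefl _)⟩
    · exact ⟨fun _ => (h1 j (by omega)).2.2, fun h => absurd h (by omega)⟩
    · exact ⟨fun h => absurd h (by omega), fun _ => (h1 i (by omega)).1.2⟩
    · have := h2 i (by omega) j (by omega)
      exact ⟨fun h => this.1 (by omega), fun h => this.2 (by omega)⟩

end HasLadder

/-- Sets that are shattered to a large depth contain long ladders. -/
theorem exists_ladder_of_shatters {A P : Type*} [Nonempty A] [Nonempty P] (low high mid : P → Set A)
    (a b : ℕ) : ∃ K, ∀ G H, Shatters low high K G H →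
      HasLadder mid low a G H ∨ HasLadder (fun p => (mid p)ᶜ) high b G H := by
  induction hk : a + b generalizing a b with
  | zero =>
    obtain ⟨rfl, rfl⟩ : a = 0 ∧ b = 0 := by omega
    exact ⟨0, fun G H _ => Or.inl (HasLadder.zero G H)⟩
  | succ k ih =>
    rcases a with _ | a
    · exact ⟨0, fun G H _ => Or.inl (HasLadder.zero G H)⟩
    rcases b with _ | b
    · exact ⟨0, fun G H _ => Or.inr (HasLadder.zero G H)⟩
    obtain ⟨K₁, h₁⟩ := ih a (b + 1) (by omega)
    obtain ⟨K₂, h₂⟩ := ih (a + 1) b (by omega)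
    -- Fix one point `x` and colour the queries by whether `x` lies in their middle set. A
    -- monochromatic tree supplies its root as the query paired with `x`, which costs the extra
    -- level; the ladder continues in one of its two subtrees.
    refine ⟨(K₁ + 1) + (K₂ + 1), fun G H hs => ?_⟩
    obtain ⟨x, hx⟩ := hs.nonempty
    have hH : H = (H ∩ {q | x ∈ mid q}) ∪ (H ∩ {q | x ∈ (mid q)ᶜ}) := by
      ext q
      by_cases hq : x ∈ mid q <;> simp [hq]
    rw [hH] at hs
    rcases hs.of_union with ⟨p, hp, hl, -⟩ | ⟨p, hp, -, hr⟩
    · rcases h₁ _ _ hl with h | h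
      · exact Or.inl (HasLadder.cons hx hp.1 hp.2 h)
      · exact Or.inr (h.mono le_rfl Set.inter_subset_left Set.inter_subset_left)
    · rcases h₂ _ _ hr with h | h
      · exact Or.inl (h.mono le_rfl Set.inter_subset_left Set.inter_subset_left)
      · exact Or.inr (HasLadder.cons hx hp.1 hp.2 h)

theorem indicator_one_nonneg {A : Type*} (G : Set A) (x : A) : 0 ≤ G.indicator (1 : A → ℝ) x :=
  Set.indicator_nonneg (fun _ _ => zero_le_one) x

/-! ### Triangle defects and their exponential moments -/

section Defect

variable {V : Type*} [SeminormedAddCommGroup V]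

/-- The defect `‖x - y‖ - ‖x‖ - ‖y‖` of the triangle inequality. -/
def normDefect (x y : V) : ℝ := ‖x - y‖ - ‖x‖ - ‖y‖

theorem normDefect_nonpos (x y : V) : normDefect x y ≤ 0 := by
  have := norm_sub_le x y
  unfold normDefect
  linarith

theorem abs_normDefect_le_left (x y : V) : |normDefect x y| ≤ 2 * ‖x‖ := by
  rw [abs_of_nonpos (normDefect_nonpos x y)]
  have := norm_sub_norm_le y x
  rw [norm_sub_rev] at this
  unfold normDefect
  linarith

theorem abs_normDefect_le_right (x y : V) : |normDefect x y| ≤ 2 * ‖y‖ := by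
  rw [abs_of_nonpos (normDefect_nonpos x y)]
  have := norm_sub_norm_le x y
  unfold normDefect
  linarith

theorem normDefect_smul [NormedSpace ℝ V] {a : ℝ} (ha : 0 ≤ a) (x y : V) :
    normDefect (a • x) (a • y) = a * normDefect x y := by
  simp only [normDefect, ← smul_sub, norm_smul, Real.norm_of_nonneg ha]
  ring

/-- The signed defect, penalized by a multiple of the norms. -/
def penalizedDefect (η : ℝ) (e : Bool) (x y : V) : ℝ :=
  boolSign e * normDefect x y - η * ‖x‖ - η * ‖y‖

theorem penalizedDefect_smul [NormedSpace ℝ V] {a : ℝ} (ha : 0 ≤ a) (η : ℝ) (e : Bool) (x y : V) :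
    penalizedDefect η e (a • x) (a • y) = a * penalizedDefect η e x y := by
  simp only [penalizedDefect, normDefect_smul ha, norm_smul, Real.norm_of_nonneg ha]
  ring

/-- The penalized signed defects along paths in trees of depth `n` have nonpositive mean, for every
labelling of the nodes and leaves by elements of `V`. -/
def DefectBound (V : Type*) [SeminormedAddCommGroup V] (η : ℝ) (n : ℕ) : Prop :=
  ∀ b x : List Bool → V, pathAvg n (fun l => pathSum (penalizedDefect η) b (x l) l) ≤ 0

/-- The points whose defect at `p.1` is at most `p.2`. -/
def defectLow (p : V × ℝ) : Set V := {x | normDefect x p.1 ≤ p.2}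

/-- The points whose defect at `p.1` is at least `p.2 + δ`. -/
def defectHigh (δ : ℝ) (p : V × ℝ) : Set V := {x | p.2 + δ ≤ normDefect x p.1}

/-- The points of norm between `1` and `2`. -/
def unitShell (V : Type*) [SeminormedAddCommGroup V] : Set V := {x | 1 ≤ ‖x‖ ∧ ‖x‖ ≤ 2}

/-- A set that is not shattered splits, at each query of bounded norm, into two sets that are
shattered to a smaller depth and one on which the defect is almost constant. -/
theorem exists_split_of_not_shatters {δ M : ℝ} (hδ : 0 < δ) {r : ℕ} {G : Set V}
    (hG : G ⊆ unitShell V) {y : V} (hy : ‖y‖ ≤ M)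
    (hr : ¬ Shatters defectLow (defectHigh δ) (r + 1) G {p | ‖p.1‖ ≤ M})
    (hr' : Shatters defectLow (defectHigh δ) r G {p | ‖p.1‖ ≤ M}) :
    ∃ s : ℝ, |s + δ| ≤ 4 ∧
      ¬ Shatters defectLow (defectHigh δ) r (G ∩ defectLow (y, s)) {p | ‖p.1‖ ≤ M} ∧
      ¬ Shatters defectLow (defectHigh δ) r (G ∩ defectHigh δ (y, s + δ)) {p | ‖p.1‖ ≤ M} := by
  classical
  set H : Set (V × ℝ) := {p | ‖p.1‖ ≤ M}
  -- Thresholds with spacing `δ`. At `n = 0` the upper set is all of `G`, still shattered to depth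
  -- `r`. At the first threshold where the upper set fails to be, the preceding threshold has a
  -- shattered upper set, so its lower set cannot be shattered as well.
  let s : ℕ → ℝ := fun n => -4 - δ + n * δ
  have hlow : ∀ x ∈ G, -4 ≤ normDefect x y := fun x hx => by
    have := neg_le_of_abs_le (abs_normDefect_le_left x y)
    linarith [(hG hx).2]
  have hbdd : ∀ n, Shatters defectLow (defectHigh δ) r (G ∩ defectHigh δ (y, s n)) H →
      s n + δ ≤ 0 := fun n hn => by
    obtain ⟨x, -, hx⟩ := hn.nonempty
    exact le_trans hx (normDefect_nonpos x y)
  have hex : ∃ n, ¬ Shatters defectLow (defectHigh δ) r (G ∩ defectHigh δ (y, s n)) H := by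
    obtain ⟨n, hn⟩ := exists_nat_gt (4 / δ)
    refine ⟨n, fun h => ?_⟩
    have := hbdd n h
    rw [div_lt_iff₀ hδ] at hn
    simp only [s] at this
    linarith
  have h0 : Nat.find hex ≠ 0 := fun h => by
    have := Nat.find_spec hex
    rw [h] at this
    refine this (hr'.mono (fun x hx => ⟨hx, ?_⟩) le_rfl)
    simpa [defectHigh, s] using hlow x hx
  obtain ⟨n, hn⟩ := Nat.exists_eq_succ_of_ne_zero h0
  have hn1 : Shatters defectLow (defectHigh δ) r (G ∩ defectHigh δ (y, s n)) H :=
    not_not.1 (Nat.find_min hex (by omega))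
  have hn2 := Nat.find_spec hex
  rw [hn] at hn2
  refine ⟨s n, abs_le.2 ⟨?_, by linarith [hbdd n hn1]⟩, fun h => hr ⟨(y, s n), hy, h, hn1⟩, ?_⟩
  · have : 0 ≤ (n : ℝ) * δ := by positivity
    simp only [s]
    linarith
  · convert hn2 using 5
    simp only [s, Nat.succ_eq_add_one]
    push_cast
    ring

theorem mul_exp_add_le {i a c t : ℝ} (hi : 0 ≤ i) (h : c ≤ a) :
    i * Real.exp (c + t) ≤ Real.exp a * (i * Real.exp t) := by
  rw [Real.exp_add]
  have := Real.exp_le_exp.2 h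
  have h2 : 0 ≤ i * Real.exp t := by positivity
  nlinarith

/-- The exponential moments of the penalized defects grow polynomially in the depth of the tree, if
the set of leaf labels is not shattered to depth `r`. -/
theorem pathAvg_exp_le {η δ M : ℝ} (hη : 0 < η) (hδ : δ = η / 2) (hM : M = 4 / η) {r : ℕ}
    {G : Set V} (hG : G ⊆ unitShell V)
    (hr : ¬ Shatters defectLow (defectHigh δ) r G {p | ‖p.1‖ ≤ M}) (n : ℕ) (b x : List Bool → V) :
    pathAvg n (fun l => G.indicator 1 (x l) *
        Real.exp (η / 16 * pathSum (penalizedDefect η) b (x l) l)) ≤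
      (1 + 2 * Real.exp (η / 4) * n) ^ r := by
  have hδ0 : 0 < δ := by rw [hδ]; positivity
  induction n generalizing r G b x with
  | zero =>
    simp only [pathAvg, pathSum, mul_zero, Real.exp_zero, mul_one, Nat.cast_zero, add_zero, one_pow]
    exact Set.indicator_le_self' (fun _ _ => zero_le_one) _
  | succ n ih =>
    set κ := 2 * Real.exp (η / 4) with hκ
    have hκ0 : 0 < κ := by positivity
    induction r generalizing G with
    | zero =>
      have : G = ∅ := Set.not_nonempty_iff_eq_empty.1 hr
      subst this
      simp [pathAvg_const]
    | succ r ihr =>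
      have hu1 : 1 ≤ 1 + κ * (n + 1 : ℕ) := by
        have : 0 ≤ κ * (n + 1 : ℕ) := by positivity
        linarith
      by_cases hr' : Shatters defectLow (defectHigh δ) r G {p | ‖p.1‖ ≤ M}
      swap
      · exact (ihr hG hr').trans (pow_le_pow_right₀ hu1 (Nat.le_succ r))
      -- The recursion of Sauer–Shelah type: one term of the same rank for the middle set, and one
      -- of smaller rank for the two outer sets.
      have hu : (1 + κ * n) ^ (r + 1) + κ * (1 + κ * n) ^ r ≤ (1 + κ * (n + 1 : ℕ)) ^ (r + 1) := by
        have h1 : (0 : ℝ) ≤ 1 + κ * n := by positivity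
        have h2 : 1 + κ * (n + 1 : ℕ) = (1 + κ * n) + κ := by push_cast; ring
        have h3 : (1 + κ * n) ^ r ≤ ((1 + κ * n) + κ) ^ r :=
          pow_le_pow_left₀ h1 (by linarith) r
        rw [h2, pow_succ, pow_succ]
        nlinarith
      have hpow : 0 ≤ κ * (1 + κ * n) ^ r := by positivity
      simp only [pathAvg, pathSum, mul_add]
      set y := b [] with hy
      by_cases hyM : ‖y‖ ≤ M
      · obtain ⟨s, hs, hL, hH⟩ := exists_split_of_not_shatters hδ0 hG hyM hr hr'
        set m := s + δ with hm
        set Lo := G ∩ defectLow (y, s)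
        set Hi := G ∩ defectHigh δ (y, m)
        set Mi := G ∩ {z | |normDefect z y - m| ≤ δ}
        have hLG : Lo ⊆ unitShell V := Set.inter_subset_left.trans hG
        have hHG : Hi ⊆ unitShell V := Set.inter_subset_left.trans hG
        have hMG : Mi ⊆ unitShell V := Set.inter_subset_left.trans hG
        have hMi : ¬ Shatters defectLow (defectHigh δ) (r + 1) Mi {p | ‖p.1‖ ≤ M} :=
          fun h => hr (h.mono Set.inter_subset_left le_rfl)
        have hcov : ∀ z, G.indicator (1 : V → ℝ) z ≤
            Lo.indicator 1 z + Hi.indicator 1 z + Mi.indicator 1 z := by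
          intro z
          have h1 := indicator_one_nonneg Lo z
          have h2 := indicator_one_nonneg Hi z
          have h3 := indicator_one_nonneg Mi z
          by_cases hz : z ∈ G
          · rw [Set.indicator_of_mem hz, Pi.one_apply]
            rcases le_or_gt (normDefect z y) s with hz1 | hz1
            · have : z ∈ Lo := ⟨hz, hz1⟩
              rw [Set.indicator_of_mem this, Pi.one_apply]
              linarith
            rcases le_or_gt (m + δ) (normDefect z y) with hz2 | hz2
            · have : z ∈ Hi := ⟨hz, hz2⟩
              rw [Set.indicator_of_mem this, Pi.one_apply]
              linarith
            · have hzm : |normDefect z y - m| ≤ δ := abs_le.2 ⟨by linarith, by linarith⟩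
              have : z ∈ Mi := ⟨hz, hzm⟩
              rw [Set.indicator_of_mem this, Pi.one_apply]
              linarith
          · rw [Set.indicator_of_notMem hz]
            linarith
        -- On the outer sets the rank drops, so a wasteful estimate of this step is affordable.
        have hcrude : ∀ e, ∀ z ∈ unitShell V, η / 16 * penalizedDefect η e z y ≤ η / 4 := by
          intro e z hz
          have h1 := boolSign_mul_le_abs e (normDefect z y)
          have h2 := abs_normDefect_le_left z y
          have h3 : 0 ≤ η * ‖z‖ := by positivity
          have h4 : 0 ≤ η * ‖y‖ := by positivity
          have h5 : penalizedDefect η e z y ≤ 4 := by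
            unfold penalizedDefect
            linarith [hz.2]
          nlinarith
        -- On the middle set the defect is the constant `m` up to `δ = η / 2`. The penalty is at
        -- least `η`, since `‖z‖ ≥ 1`; half of it absorbs the error.
        have hfine : ∀ e, ∀ z ∈ Mi, η / 16 * penalizedDefect η e z y ≤
            boolSign e * (η / 16 * m) - η ^ 2 / 32 := by
          intro e z hz
          have h1 := boolSign_mul_le_abs e (normDefect z y - m)
          have h2 : η * 1 ≤ η * ‖z‖ := by gcongr; exact (hMG hz).1
          have h4 : 0 ≤ η * ‖y‖ := by positivity
          have h5 : penalizedDefect η e z y ≤ boolSign e * m - η / 2 := by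
            have hzm : |normDefect z y - m| ≤ δ := hz.2
            unfold penalizedDefect
            linarith
          have h6 : 0 ≤ η / 16 := by positivity
          calc η / 16 * penalizedDefect η e z y ≤ η / 16 * (boolSign e * m - η / 2) := by gcongr
            _ = _ := by ring
        have hstep : ∀ e, pathAvg n (fun l => G.indicator 1 (x (e :: l)) *
            Real.exp (η / 16 * penalizedDefect η e (x (e :: l)) y + η / 16 *
              pathSum (penalizedDefect η) (fun k => b (e :: k)) (x (e :: l)) l)) ≤
            κ * (1 + κ * n) ^ r +
              Real.exp (boolSign e * (η / 16 * m) - η ^ 2 / 32) * (1 + κ * n) ^ (r + 1) := by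
          intro e
          have key : ∀ (S : Set V) (a : ℝ),
              (∀ z ∈ S, η / 16 * penalizedDefect η e z y ≤ a) → ∀ z t,
              S.indicator 1 z * Real.exp (η / 16 * penalizedDefect η e z y + t) ≤
                Real.exp a * (S.indicator 1 z * Real.exp t) := by
            intro S a hS z t
            by_cases hz : z ∈ S
            · exact mul_exp_add_le (indicator_one_nonneg S z) (hS z hz)
            · simp [Set.indicator_of_notMem hz]
          calc _ ≤ pathAvg n (fun l =>
                (Real.exp (η / 4) * (Lo.indicator 1 (x (e :: l)) * Real.exp (η / 16 *
                  pathSum (penalizedDefect η) (fun k => b (e :: k)) (x (e :: l)) l)) +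
                Real.exp (η / 4) * (Hi.indicator 1 (x (e :: l)) * Real.exp (η / 16 *
                  pathSum (penalizedDefect η) (fun k => b (e :: k)) (x (e :: l)) l))) +
                Real.exp (boolSign e * (η / 16 * m) - η ^ 2 / 32) *
                  (Mi.indicator 1 (x (e :: l)) * Real.exp (η / 16 *
                  pathSum (penalizedDefect η) (fun k => b (e :: k)) (x (e :: l)) l))) := by
                refine pathAvg_mono fun l _ => ?_
                refine (mul_le_mul_of_nonneg_right (hcov _) (Real.exp_pos _).le).trans ?_
                rw [add_mul, add_mul]
                exact add_le_add (add_le_add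
                  (key Lo _ (fun z hz => hcrude e z (hLG hz)) _ _)
                  (key Hi _ (fun z hz => hcrude e z (hHG hz)) _ _))
                  (key Mi _ (hfine e) _ _)
            _ ≤ Real.exp (η / 4) * (1 + κ * n) ^ r + Real.exp (η / 4) * (1 + κ * n) ^ r +
                Real.exp (boolSign e * (η / 16 * m) - η ^ 2 / 32) * (1 + κ * n) ^ (r + 1) := by
                simp only [pathAvg_add, pathAvg_mul]
                gcongr
                · exact ih hLG hL _ (fun l => x (e :: l))
                · exact ih hHG hH _ (fun l => x (e :: l))
                · exact ih hMG hMi _ (fun l => x (e :: l))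
            _ = _ := by rw [hκ]; ring
        -- Averaging the sign gives a hyperbolic cosine, at most `exp (η ^ 2 / 32)` because `|m| ≤
        -- 4`. The remaining penalty cancels this exactly, so the middle set contributes no growth.
        have hcosh : (Real.exp (boolSign false * (η / 16 * m) - η ^ 2 / 32) +
            Real.exp (boolSign true * (η / 16 * m) - η ^ 2 / 32)) / 2 ≤ 1 := by
          have h1 := Real.cosh_le_exp_half_sq (η / 16 * m)
          have h2 : m ^ 2 ≤ 16 := by nlinarith [abs_le.1 hs]
          have h3 : Real.exp ((η / 16 * m) ^ 2 / 2) ≤ Real.exp (η ^ 2 / 32) := by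
            apply Real.exp_le_exp.2
            nlinarith [sq_nonneg η, mul_nonneg (sq_nonneg η) (sub_nonneg.2 h2)]
          rw [Real.cosh_eq] at h1
          have h4 : Real.exp (η ^ 2 / 32) * Real.exp (-(η ^ 2 / 32)) = 1 := by
            rw [← Real.exp_add]; simp
          have h5 := Real.exp_pos (-(η ^ 2 / 32))
          simp only [boolSign_false, boolSign_true, neg_mul, one_mul, sub_eq_add_neg, Real.exp_add]
          nlinarith
        have h0 := hstep false
        have h1 := hstep true
        have h2 := mul_le_mul_of_nonneg_right hcosh
          (show 0 ≤ (1 + κ * (n : ℝ)) ^ (r + 1) by positivity)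
        push_cast at hu ⊢
        linarith
      -- For a label of norm above `M = 4 / η` the penalty `η * ‖y‖` exceeds the defect, which is at
      -- most `2 * ‖z‖ ≤ 4` in absolute value.
      · have hstep : ∀ e, pathAvg n (fun l => G.indicator 1 (x (e :: l)) *
            Real.exp (η / 16 * penalizedDefect η e (x (e :: l)) y + η / 16 *
              pathSum (penalizedDefect η) (fun k => b (e :: k)) (x (e :: l)) l)) ≤
            (1 + κ * n) ^ (r + 1) := by
          intro e
          refine le_trans (pathAvg_mono fun l _ => ?_)
            (ih hG hr (fun k => b (e :: k)) (fun l => x (e :: l)))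
          by_cases hz : x (e :: l) ∈ G
          · refine mul_le_mul_of_nonneg_left ?_ (indicator_one_nonneg _ _)
            apply Real.exp_le_exp.2
            have h1 := boolSign_mul_le_abs e (normDefect (x (e :: l)) y)
            have h2 := abs_normDefect_le_left (x (e :: l)) y
            have h3 : 0 ≤ η * ‖x (e :: l)‖ := by positivity
            have h4 : 4 ≤ η * ‖y‖ := by
              have := not_le.1 hyM
              rw [hM, div_lt_iff₀ hη] at this
              linarith
            have h5 : penalizedDefect η e (x (e :: l)) y ≤ 0 := by
              unfold penalizedDefect
              linarith [(hG hz).2]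
            nlinarith
          · simp [Set.indicator_of_notMem hz]
        have h0 := hstep false
        have h1 := hstep true
        push_cast at hu ⊢
        linarith

end Defect

/-! ### Leaves in the unit shell -/

theorem max_zero_le_exp_div {a t : ℝ} (ha : 0 < a) : max 0 t ≤ Real.exp (a * t) / a := by
  rw [le_div_iff₀ ha]
  rcases max_cases 0 t with ⟨h, -⟩ | ⟨h, -⟩ <;> rw [h]
  · simpa using (Real.exp_pos _).le
  · linarith [Real.add_one_le_exp (a * t)]

section Shell

variable {V : Type*} [SeminormedAddCommGroup V]

/-- The constant in `pathAvg_shell_le`. -/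
noncomputable def shellConst (η : ℝ) (r N : ℕ) : ℝ :=
  Real.exp (-(η / 16 * (η * N))) * (1 + 2 * Real.exp (η / 4) * N) ^ r / (η / 16)

theorem tendsto_shellConst {η : ℝ} (hη : 0 < η) (r : ℕ) :
    Tendsto (shellConst η r) atTop (𝓝 0) := by
  set κ := 2 * Real.exp (η / 4)
  have hκ : 0 < κ := by positivity
  set q := Real.exp (-(η / 16 * η)) with hq
  have hq1 : q < 1 := Real.exp_lt_one_iff.2 (neg_lt_zero.2 (by positivity))
  have h1 : Tendsto (fun N : ℕ => ((N : ℝ) ^ r * q ^ N) * ((1 + κ) ^ r / (η / 16))) atTop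
      (𝓝 0) := by
    simpa using (tendsto_pow_const_mul_const_pow_of_lt_one r (Real.exp_pos _).le hq1).mul_const
      ((1 + κ) ^ r / (η / 16))
  refine squeeze_zero' (Eventually.of_forall fun N => ?_) ?_ h1
  · unfold shellConst
    positivity
  · filter_upwards [eventually_ge_atTop 1] with N hN
    have hN' : (1 : ℝ) ≤ N := by exact_mod_cast hN
    have hexp : Real.exp (-(η / 16 * (η * N))) = q ^ N := by
      rw [hq, ← Real.exp_nat_mul]
      congr 1
      ring
    have h2 : (1 + κ * N) ^ r ≤ ((1 + κ) * N) ^ r := by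
      refine pow_le_pow_left₀ (by positivity) ?_ r
      nlinarith
    unfold shellConst
    rw [hexp]
    calc q ^ N * (1 + κ * N) ^ r / (η / 16) ≤ q ^ N * ((1 + κ) * N) ^ r / (η / 16) := by gcongr
      _ = _ := by rw [mul_pow]; ring

/-- The contribution of the leaves with labels in the unit shell is controlled by the number of
nodes with large labels. -/
theorem pathAvg_shell_le {η : ℝ} (hη : 0 < η) {r : ℕ}
    (hr : ¬ Shatters defectLow (defectHigh (η / 2)) r (unitShell V) {p | ‖p.1‖ ≤ 4 / η})
    {N n : ℕ} (hn : n ≤ N) (b x : List Bool → V) :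
    pathAvg n (fun l => (unitShell V).indicator 1 (x l) *
        max 0 (pathSum (penalizedDefect η) b (x l) l - η * N)) ≤
      shellConst η r N *
        pathAvg n (fun l => pathSum (fun _ _ y => {y : V | η / 2 < ‖y‖}.indicator 1 y) b (x l) l) := by
  have hK : 0 ≤ shellConst η r N := by unfold shellConst; positivity
  induction n generalizing b x with
  | zero =>
    have h : 0 ≤ η * N := by positivity
    simp [pathAvg, pathSum, h]
  | succ n ih =>
    set y := b [] with hy
    -- Nodes with small labels have nonpositive cost and are skipped. At the first large label on a
    -- branch, the exponential moment bound handles the whole remaining subtree, and the count on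
    -- the right is at least one.
    by_cases hyη : η / 2 < ‖y‖
    · have h1 : shellConst η r N * 1 ≤ shellConst η r N * pathAvg (n + 1)
          (fun l => pathSum (fun _ _ y => {y : V | η / 2 < ‖y‖}.indicator 1 y) b (x l) l) := by
        refine mul_le_mul_of_nonneg_left (le_pathAvg ?_) hK
        rintro (_ | ⟨e, l⟩) hl
        · simp at hl
        · have : b [] ∈ {y : V | η / 2 < ‖y‖} := hyη
          simp only [pathSum]
          rw [Set.indicator_of_mem this, Pi.one_apply]
          have := pathSum_nonneg (c := fun _ (_ : V) y => {y : V | η / 2 < ‖y‖}.indicator 1 y)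
            (x := x (e :: l)) (fun _ y => indicator_one_nonneg _ y) (fun k => b (e :: k)) l
          linarith
      refine le_trans ?_ h1
      calc _ ≤ pathAvg (n + 1) (fun l => Real.exp (-(η / 16 * (η * N))) / (η / 16) *
            ((unitShell V).indicator 1 (x l) *
              Real.exp (η / 16 * pathSum (penalizedDefect η) b (x l) l))) := by
            refine pathAvg_mono fun l _ => ?_
            have h2 := max_zero_le_exp_div (a := η / 16)
              (t := pathSum (penalizedDefect η) b (x l) l - η * N) (by positivity)
            refine (mul_le_mul_of_nonneg_left h2 (indicator_one_nonneg _ _)).trans_eq ?_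
            rw [mul_sub, sub_eq_add_neg, Real.exp_add]
            ring
        _ ≤ Real.exp (-(η / 16 * (η * N))) / (η / 16) *
            (1 + 2 * Real.exp (η / 4) * (n + 1 : ℕ)) ^ r := by
            rw [pathAvg_mul]
            gcongr
            exact pathAvg_exp_le hη rfl rfl le_rfl hr (n + 1) b x
        _ ≤ Real.exp (-(η / 16 * (η * N))) / (η / 16) *
            (1 + 2 * Real.exp (η / 4) * N) ^ r := by
            gcongr
        _ = _ := by unfold shellConst; ring
    · have hstep : ∀ e, pathAvg n (fun l => (unitShell V).indicator 1 (x (e :: l)) *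
          max 0 (penalizedDefect η e (x (e :: l)) y +
            pathSum (penalizedDefect η) (fun k => b (e :: k)) (x (e :: l)) l - η * N)) ≤
          shellConst η r N * pathAvg n (fun l => {y : V | η / 2 < ‖y‖}.indicator 1 y +
            pathSum (fun _ _ y => {y : V | η / 2 < ‖y‖}.indicator 1 y)
            (fun k => b (e :: k)) (x (e :: l)) l) := by
        intro e
        have hy0 : y ∉ {y : V | η / 2 < ‖y‖} := hyη
        rw [Set.indicator_of_notMem hy0]
        simp only [zero_add]
        refine le_trans (pathAvg_mono fun l _ => ?_)
          (ih (by omega) (fun k => b (e :: k)) (fun l => x (e :: l)))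
        by_cases hz : x (e :: l) ∈ unitShell V
        · refine mul_le_mul_of_nonneg_left (max_le_max le_rfl ?_) (indicator_one_nonneg _ _)
          have h1 := boolSign_mul_le_abs e (normDefect (x (e :: l)) y)
          have h2 := abs_normDefect_le_right (x (e :: l)) y
          have h3 : η * 1 ≤ η * ‖x (e :: l)‖ := by gcongr; exact hz.1
          have h4 : 0 ≤ η * ‖y‖ := by positivity
          have h5 : penalizedDefect η e (x (e :: l)) y ≤ 0 := by
            unfold penalizedDefect
            linarith
          linarith
        · simp [Set.indicator_of_notMem hz]
      have h0 := hstep false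
      have h1 := hstep true
      simp only [pathAvg, pathSum, ← hy] at h0 h1 ⊢
      linarith

end Shell

/-! ### Summation over dyadic scales -/

section Scales

variable {V : Type*} [SeminormedAddCommGroup V] [NormedSpace ℝ V]

theorem pathSum_penalizedDefect_smul {a : ℝ} (ha : 0 ≤ a) (η : ℝ) (b : List Bool → V) (x : V)
    (l : List Bool) :
    pathSum (penalizedDefect η) (fun k => a • b k) (a • x) l =
      a * pathSum (penalizedDefect η) b x l := by
  induction l generalizing b with
  | nil => simp [pathSum]
  | cons e l ih => simp only [pathSum, penalizedDefect_smul ha, ih]; ring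

theorem pathSum_comp {A B C : Type*} (c : Bool → A → C → ℝ) (g : B → C) (b : List Bool → B) (x : A)
    (l : List Bool) :
    pathSum c (fun k => g (b k)) x l = pathSum (fun e x y => c e x (g y)) b x l := by
  induction l generalizing b with
  | nil => rfl
  | cons e l ih => simp only [pathSum, ih]

theorem pathSum_left_irrel {A A' B : Type*} (c : Bool → B → ℝ) (b : List Bool → B) (x : A) (x' : A')
    (l : List Bool) :
    pathSum (fun e _ y => c e y) b x l = pathSum (fun e _ y => c e y) b x' l := by
  induction l generalizing b with
  | nil => rfl
  | cons e l ih => simp only [pathSum, ih]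

theorem pathAvg_scaled_shell_le {η : ℝ} (hη : 0 < η) {r : ℕ}
    (hr : ¬ Shatters defectLow (defectHigh (η / 2)) r (unitShell V) {p | ‖p.1‖ ≤ 4 / η})
    {N : ℕ} (b x : List Bool → V) {σ : ℝ} (hσ : 0 < σ) :
    pathAvg N (fun l => {z : V | σ⁻¹ • z ∈ unitShell V}.indicator 1 (x l) *
        max 0 (pathSum (penalizedDefect η) b (x l) l - η * N * σ)) ≤
      shellConst η r N * pathAvg N (fun l =>
        pathSum (fun _ _ y => σ * {y : V | σ * (η / 2) < ‖y‖}.indicator 1 y) b (x l) l) := by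
  have h := mul_le_mul_of_nonneg_left
    (pathAvg_shell_le hη hr (le_refl N) (fun k => σ⁻¹ • b k) (fun k => σ⁻¹ • x k)) hσ.le
  simp only [pathSum_penalizedDefect_smul (inv_pos.2 hσ).le] at h
  rw [mul_left_comm, ← pathAvg_mul, ← pathAvg_mul] at h
  refine le_trans (le_of_eq ?_) (h.trans (le_of_eq ?_))
  · congr 1
    funext l
    rw [mul_left_comm, mul_max_of_nonneg _ _ hσ.le]
    have e1 : σ * (σ⁻¹ * pathSum (penalizedDefect η) b (x l) l - η * N) =
        pathSum (penalizedDefect η) b (x l) l - η * N * σ := by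
      field_simp
    rw [e1, mul_zero]
    rfl
  · congr 2
    funext l
    rw [pathSum_mul, pathSum_comp, pathSum_left_irrel (x' := x l)]
    congr 2
    funext _ _ y
    have : (σ⁻¹ • y ∈ {y : V | η / 2 < ‖y‖}) ↔ y ∈ {y : V | σ * (η / 2) < ‖y‖} := by
      change η / 2 < ‖σ⁻¹ • y‖ ↔ σ * (η / 2) < ‖y‖
      rw [norm_smul, Real.norm_of_nonneg (inv_pos.2 hσ).le, inv_mul_eq_div, lt_div_iff₀ hσ,
        mul_comm]
    by_cases hy : y ∈ {y : V | σ * (η / 2) < ‖y‖}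
    · rw [Set.indicator_of_mem hy, Set.indicator_of_mem (this.2 hy)]
      rfl
    · rw [Set.indicator_of_notMem hy, Set.indicator_of_notMem (fun h => hy (this.1 h))]

theorem sum_two_zpow_le (s : Finset ℤ) (m : ℤ) (h : ∀ k ∈ s, k ≤ m) :
    ∑ k ∈ s, (2 : ℝ) ^ k ≤ 2 * 2 ^ m := by
  induction s using Finset.induction_on_max generalizing m with
  | empty =>
    simp only [Finset.sum_empty]
    positivity
  | insert a s ha ih =>
    rw [Finset.sum_insert (fun h => lt_irrefl _ (ha a h))]
    have h1 := ih (a - 1) (fun k hk => by have := ha k hk; omega)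
    have h2 : (2 : ℝ) * 2 ^ (a - 1) = 2 ^ a := by
      rw [zpow_sub_one₀ two_ne_zero]
      field_simp
    have h3 : (2 : ℝ) ^ a ≤ 2 ^ m :=
      zpow_le_zpow_right₀ one_le_two (h a (Finset.mem_insert_self _ _))
    linarith

/-- A geometric sum is at most twice its largest admissible term. This lets a node label pay for all
the scales at which it counts as large. -/
theorem sum_two_zpow_indicator_le (s : Finset ℤ) {a t : ℝ} (ha : 0 < a) (ht : 0 ≤ t) :
    ∑ k ∈ s, (2 : ℝ) ^ k * (if 2 ^ k * a < t then 1 else 0) ≤ 2 * (t / a) := by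
  simp only [mul_ite, mul_one, mul_zero]
  rw [← Finset.sum_filter]
  rcases (s.filter fun k : ℤ => (2 : ℝ) ^ k * a < t).eq_empty_or_nonempty with h | h
  · rw [h, Finset.sum_empty]
    positivity
  · have hm := Finset.mem_filter.1 (Finset.max'_mem _ h)
    refine (sum_two_zpow_le _ (Finset.max' _ h) fun k hk => Finset.le_max' _ k hk).trans ?_
    have := hm.2.le
    rw [← le_div_iff₀ ha] at this
    linarith

/-- If the unit shell is not shattered to some depth, then the penalized signed defects have
nonpositive mean in all sufficiently deep trees. -/
theorem exists_defectBound {η : ℝ} (hη : 0 < η) {r : ℕ}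
    (hr : ¬ Shatters defectLow (defectHigh (η / 2)) r (unitShell V) {p | ‖p.1‖ ≤ 4 / η}) :
    ∃ N : ℕ, 0 < N ∧ DefectBound V (2 * η) N := by
  classical
  -- Summing the scales costs `4 * ‖y‖ / η` per node, so a constant below `η * η / 4` brings the
  -- total under `η * ‖y‖`.
  obtain ⟨N, hN, hN0⟩ := (((tendsto_shellConst hη r).eventually_lt_const
    (show (0 : ℝ) < η * η / 4 by positivity)).and (eventually_gt_atTop 0)).exists
  refine ⟨N, hN0, fun b x => ?_⟩
  set K := shellConst η r N with hKdef
  have hK : 0 ≤ K := by rw [hKdef]; unfold shellConst; positivity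
  have hex : ∀ z : V, ∃ k : ℤ, 0 < ‖z‖ → (2 : ℝ) ^ k ≤ ‖z‖ ∧ ‖z‖ < 2 ^ (k + 1) := by
    intro z
    by_cases hz : 0 < ‖z‖
    · obtain ⟨k, hk⟩ := exists_mem_Ico_zpow hz one_lt_two
      exact ⟨k, fun _ => ⟨hk.1, hk.2⟩⟩
    · exact ⟨0, fun h => absurd h hz⟩
  choose scale hscale using hex
  set s : Finset ℤ := (List.finite_length_eq Bool N).toFinset.image fun l => scale (x l) with hs
  have hpt : ∀ l : List Bool, l.length = N → pathSum (penalizedDefect (2 * η)) b (x l) l ≤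
      ∑ k ∈ s, {z : V | ((2 : ℝ) ^ k)⁻¹ • z ∈ unitShell V}.indicator 1 (x l) *
        max 0 (pathSum (penalizedDefect η) b (x l) l - η * N * 2 ^ k) +
      pathSum (fun _ _ y => -η * ‖y‖) b (x l) l := by
    intro l hl
    have hnn : ∀ k ∈ s, 0 ≤ {z : V | ((2 : ℝ) ^ k)⁻¹ • z ∈ unitShell V}.indicator 1 (x l) *
        max 0 (pathSum (penalizedDefect η) b (x l) l - η * N * 2 ^ k) := fun k _ =>
      mul_nonneg (indicator_one_nonneg _ _) (le_max_left _ _)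
    -- Half of the doubled penalty stays in the path sum. The other half splits: its leaf part `η *
    -- N * ‖x l‖` provides the offset in the shell estimate, and its node part pays for the sum over
    -- scales.
    have hsplit : pathSum (penalizedDefect (2 * η)) b (x l) l =
        pathSum (penalizedDefect η) b (x l) l - η * N * ‖x l‖ +
          pathSum (fun _ _ y => -η * ‖y‖) b (x l) l := by
      have h1 : (penalizedDefect (2 * η) : Bool → V → V → ℝ) =
          fun e x y => (penalizedDefect η e x y + -η * ‖x‖) + -η * ‖y‖ := by
        funext e x y
        unfold penalizedDefect
        ring
      rw [h1, pathSum_add, pathSum_add, pathSum_left, hl]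
      ring
    rw [hsplit]
    gcongr
    rcases (norm_nonneg (x l)).eq_or_lt' with h0 | hpos
    · refine le_trans ?_ (Finset.sum_nonneg hnn)
      rw [h0, mul_zero, sub_zero]
      have h2 : pathSum (penalizedDefect η) b (x l) l ≤ pathSum (fun _ _ _ => (0 : ℝ)) b (x l) l := by
        refine pathSum_mono (fun e y => ?_) b l
        have h3 := boolSign_mul_le_abs e (normDefect (x l) y)
        have h4 := abs_normDefect_le_left (x l) y
        have h5 : 0 ≤ η * ‖y‖ := by positivity
        unfold penalizedDefect
        rw [h0] at h4 ⊢
        linarith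
      exact h2.trans_eq (by rw [pathSum_left (fun _ => (0 : ℝ)), mul_zero])
    · have hmem : scale (x l) ∈ s := Finset.mem_image_of_mem _ (by simpa using hl)
      refine le_trans ?_ (Finset.single_le_sum hnn hmem)
      obtain ⟨h1, h2⟩ := hscale (x l) hpos
      have hp : (0 : ℝ) < 2 ^ scale (x l) := by positivity
      have hin : x l ∈ {z : V | ((2 : ℝ) ^ scale (x l))⁻¹ • z ∈ unitShell V} := by
        change 1 ≤ ‖((2 : ℝ) ^ scale (x l))⁻¹ • x l‖ ∧ ‖((2 : ℝ) ^ scale (x l))⁻¹ • x l‖ ≤ 2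
        rw [norm_smul, Real.norm_of_nonneg (inv_pos.2 hp).le, inv_mul_eq_div, le_div_iff₀ hp,
          div_le_iff₀ hp]
        rw [zpow_add_one₀ two_ne_zero] at h2
        exact ⟨by linarith, by linarith⟩
      rw [Set.indicator_of_mem hin, Pi.one_apply, one_mul]
      refine le_trans ?_ (le_max_right _ _)
      gcongr
  refine (pathAvg_mono hpt).trans ?_
  rw [pathAvg_add, pathAvg_sum]
  calc _ ≤ ∑ k ∈ s, K * pathAvg N (fun l => pathSum
          (fun _ _ y => 2 ^ k * {y : V | 2 ^ k * (η / 2) < ‖y‖}.indicator 1 y) b (x l) l) +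
        pathAvg N (fun l => pathSum (fun _ _ y => -η * ‖y‖) b (x l) l) := by
        gcongr with k
        exact pathAvg_scaled_shell_le hη hr b x (by positivity)
    _ = pathAvg N (fun l => pathSum (fun _ _ y =>
          K * ∑ k ∈ s, 2 ^ k * {y : V | 2 ^ k * (η / 2) < ‖y‖}.indicator 1 y + -η * ‖y‖)
            b (x l) l) := by
        rw [← Finset.mul_sum, ← pathAvg_sum, ← pathAvg_mul, ← pathAvg_add]
        congr 1
        funext l
        rw [pathSum_add, pathSum_mul K, pathSum_sum]
    _ ≤ 0 := by
        refine pathAvg_le fun l _ => ?_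
        refine (pathSum_mono (c' := fun _ _ _ => (0 : ℝ)) (fun e y => ?_) b l).trans_eq
          (by rw [pathSum_left (fun _ => (0 : ℝ)), mul_zero])
        have h1 := sum_two_zpow_indicator_le s (show 0 < η / 2 by positivity) (norm_nonneg y)
        have h2 : ∑ k ∈ s, (2 : ℝ) ^ k * {y : V | 2 ^ k * (η / 2) < ‖y‖}.indicator 1 y ≤
            2 * (‖y‖ / (η / 2)) := by
          refine le_trans (le_of_eq (Finset.sum_congr rfl fun k _ => ?_)) h1
          by_cases h : (2 : ℝ) ^ k * (η / 2) < ‖y‖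
          · have : y ∈ {y : V | 2 ^ k * (η / 2) < ‖y‖} := h
            rw [Set.indicator_of_mem this, if_pos h, Pi.one_apply]
          · have : y ∉ {y : V | 2 ^ k * (η / 2) < ‖y‖} := h
            rw [Set.indicator_of_notMem this, if_neg h]
        have h3 : K * (2 * (‖y‖ / (η / 2))) ≤ η * η / 4 * (2 * (‖y‖ / (η / 2))) := by
          gcongr
        have h4 : η * η / 4 * (2 * (‖y‖ / (η / 2))) = η * ‖y‖ := by
          field_simp
          ring
        have h5 := mul_le_mul_of_nonneg_left h2 hK
        linarith

end Scales

/-! ### Means and amenability of abelian groups -/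

/-- A real function that is bounded in absolute value. -/
def IsBoundedFun {I : Type*} (f : I → ℝ) : Prop := ∃ C, ∀ i, |f i| ≤ C

namespace IsBoundedFun

variable {I : Type*} {f g : I → ℝ}

theorem const (c : ℝ) : IsBoundedFun (fun _ : I => c) := ⟨|c|, fun _ => le_rfl⟩

theorem add (hf : IsBoundedFun f) (hg : IsBoundedFun g) : IsBoundedFun (fun i => f i + g i) := by
  obtain ⟨C, hC⟩ := hf
  obtain ⟨D, hD⟩ := hg
  exact ⟨C + D, fun i => (abs_add_le _ _).trans (add_le_add (hC i) (hD i))⟩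

theorem mul_left (c : ℝ) (hf : IsBoundedFun f) : IsBoundedFun (fun i => c * f i) := by
  obtain ⟨C, hC⟩ := hf
  exact ⟨|c| * C, fun i => by rw [abs_mul]; exact mul_le_mul_of_nonneg_left (hC i) (abs_nonneg c)⟩

theorem comp {J : Type*} (hf : IsBoundedFun f) (k : J → I) : IsBoundedFun (fun j => f (k j)) := by
  obtain ⟨C, hC⟩ := hf
  exact ⟨C, fun j => hC _⟩

/-- Bounded functions converge along ultrafilters. -/
theorem exists_tendsto (hf : IsBoundedFun f) (U : Ultrafilter I) : ∃ a, Tendsto f U (𝓝 a) := by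
  obtain ⟨C, hC⟩ := hf
  obtain ⟨a, -, ha⟩ := (isCompact_Icc (a := -C) (b := C)).ultrafilter_le_nhds' (U.map f)
    (Ultrafilter.mem_map.2 (Filter.mem_of_superset Filter.univ_mem fun i _ => abs_le.1 (hC i)))
  exact ⟨a, ha⟩

end IsBoundedFun

/-- A mean: a positive, linear and normalized functional on the bounded functions. -/
structure IsMean {I : Type*} (m : (I → ℝ) → ℝ) : Prop where
  add : ∀ f g, IsBoundedFun f → IsBoundedFun g → m (fun i => f i + g i) = m f + m g
  mul : ∀ (c : ℝ) f, IsBoundedFun f → m (fun i => c * f i) = c * m f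
  mono : ∀ f g, IsBoundedFun f → IsBoundedFun g → (∀ i, f i ≤ g i) → m f ≤ m g
  const : ∀ c, m (fun _ => c) = c

namespace IsMean

variable {I : Type*} {m : (I → ℝ) → ℝ}

theorem sub (hm : IsMean m) {f g : I → ℝ} (hf : IsBoundedFun f) (hg : IsBoundedFun g) :
    m (fun i => f i - g i) = m f - m g := by
  have h1 := hm.add f (fun i => -1 * g i) hf (hg.mul_left _)
  rw [hm.mul _ _ hg] at h1
  calc m (fun i => f i - g i) = m (fun i => f i + -1 * g i) := by congr 1; funext i; ring
    _ = _ := by rw [h1]; ring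

theorem le_const (hm : IsMean m) {f : I → ℝ} {c : ℝ} (hf : IsBoundedFun f) (h : ∀ i, f i ≤ c) :
    m f ≤ c := by
  have := hm.mono f _ hf (IsBoundedFun.const c) h
  rwa [hm.const] at this

theorem const_le (hm : IsMean m) {f : I → ℝ} {c : ℝ} (hf : IsBoundedFun f) (h : ∀ i, c ≤ f i) :
    c ≤ m f := by
  have := hm.mono _ f (IsBoundedFun.const c) hf h
  rwa [hm.const] at this

theorem abs_le_const (hm : IsMean m) {f : I → ℝ} {C : ℝ} (h : ∀ i, |f i| ≤ C) : |m f| ≤ C :=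
  abs_le.2 ⟨hm.const_le ⟨C, h⟩ fun i => (abs_le.1 (h i)).1,
    hm.le_const ⟨C, h⟩ fun i => (abs_le.1 (h i)).2⟩

theorem eval (i : I) : IsMean (fun f : I → ℝ => f i) :=
  ⟨fun _ _ _ _ => rfl, fun _ _ _ => rfl, fun _ _ _ _ h => h i, fun _ => rfl⟩

/-- Means converge along ultrafilters. -/
theorem exists_ultralimit {J : Type*} (U : Ultrafilter J) {A : J → (I → ℝ) → ℝ}
    (hA : ∀ j, IsMean (A j)) :
    ∃ m : (I → ℝ) → ℝ, IsMean m ∧ ∀ f, IsBoundedFun f → Tendsto (fun j => A j f) U (𝓝 (m f)) := by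
  have hex : ∀ f : I → ℝ, ∃ a, IsBoundedFun f → Tendsto (fun j => A j f) U (𝓝 a) := by
    intro f
    by_cases hf : IsBoundedFun f
    · obtain ⟨C, hC⟩ := hf
      have hb : IsBoundedFun (fun j => A j f) := ⟨C, fun j => (hA j).abs_le_const hC⟩
      obtain ⟨a, ha⟩ := hb.exists_tendsto U
      exact ⟨a, fun _ => ha⟩
    · exact ⟨0, fun h => absurd h hf⟩
  choose m hm using hex
  refine ⟨m, ⟨fun f g hf hg => ?_, fun c f hf => ?_, fun f g hf hg h => ?_, fun c => ?_⟩, hm⟩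
  · refine tendsto_nhds_unique (hm _ (hf.add hg)) (((hm f hf).add (hm g hg)).congr fun j => ?_)
    exact ((hA j).add f g hf hg).symm
  · refine tendsto_nhds_unique (hm _ (hf.mul_left c)) (((hm f hf).const_mul c).congr fun j => ?_)
    exact ((hA j).mul c f hf).symm
  · exact le_of_tendsto_of_tendsto' (hm f hf) (hm g hg) fun j => (hA j).mono f g hf hg h
  · refine tendsto_nhds_unique (hm _ (IsBoundedFun.const c)) (tendsto_const_nhds.congr fun j => ?_)
    exact ((hA j).const c).symm

end IsMean

section Invariant

variable {X : Type*} [AddCommGroup X]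

/-- The functional `m` is invariant under the translation by `h`. -/
def IsInvariantUnder (m : (X → ℝ) → ℝ) (h : X) : Prop :=
  ∀ f, IsBoundedFun f → m (fun z => f (z + h)) = m f

/-- The average of the translates of `f` by the multiples `k • h` with `k < n + 1`. -/
noncomputable def translateAvg (h : X) (n : ℕ) (f : X → ℝ) (z : X) : ℝ :=
  ((n : ℝ) + 1)⁻¹ * ∑ k ∈ Finset.range (n + 1), f (z + k • h)

theorem abs_translateAvg_le (h : X) (n : ℕ) {f : X → ℝ} {C : ℝ} (hC : ∀ z, |f z| ≤ C) (z : X) :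
    |translateAvg h n f z| ≤ C := by
  have hn : (0 : ℝ) < (n : ℝ) + 1 := by positivity
  unfold translateAvg
  rw [abs_mul, abs_of_pos (inv_pos.2 hn), inv_mul_le_iff₀ hn]
  refine (Finset.abs_sum_le_sum_abs _ _).trans ((Finset.sum_le_sum fun k _ => hC _).trans_eq ?_)
  simp

theorem IsBoundedFun.translateAvg {f : X → ℝ} (hf : IsBoundedFun f) (h : X) (n : ℕ) :
    IsBoundedFun (translateAvg h n f) := by
  obtain ⟨C, hC⟩ := hf
  exact ⟨C, abs_translateAvg_le h n hC⟩

theorem IsMean.comp_translateAvg {m : (X → ℝ) → ℝ} (hm : IsMean m) (h : X) (n : ℕ) :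
    IsMean (fun f => m (translateAvg h n f)) := by
  have hn : (0 : ℝ) < (n : ℝ) + 1 := by positivity
  refine ⟨fun f g hf hg => ?_, fun c f hf => ?_, fun f g hf hg hfg => ?_, fun c => ?_⟩
  · rw [← hm.add _ _ (hf.translateAvg h n) (hg.translateAvg h n)]
    congr 1
    funext z
    simp only [translateAvg, Finset.sum_add_distrib, mul_add]
  · rw [← hm.mul _ _ (hf.translateAvg h n)]
    congr 1
    funext z
    simp only [translateAvg, ← Finset.mul_sum]
    ring
  · refine hm.mono _ _ (hf.translateAvg h n) (hg.translateAvg h n) fun z => ?_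
    simp only [translateAvg]
    gcongr
    exact hfg _
  · rw [← hm.const c]
    congr 1
    funext z
    simp only [translateAvg, hm.const]
    simp
    field_simp

theorem translateAvg_translate (h g : X) (n : ℕ) (f : X → ℝ) :
    translateAvg h n (fun z => f (z + g)) = fun z => translateAvg h n f (z + g) := by
  funext z
  simp only [translateAvg, add_right_comm]

/-- The sum telescopes to its two end terms, so averaging along multiples of `h` gives invariance
under `h` in the limit. -/
theorem abs_translateAvg_sub_le (h : X) (n : ℕ) {f : X → ℝ} {C : ℝ} (hC : ∀ z, |f z| ≤ C) (z : X) :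
    |translateAvg h n (fun z => f (z + h)) z - translateAvg h n f z| ≤
      2 * C * ((n : ℝ) + 1)⁻¹ := by
  have hn : (0 : ℝ) < (n : ℝ) + 1 := by positivity
  have h1 : translateAvg h n (fun z => f (z + h)) z - translateAvg h n f z =
      ((n : ℝ) + 1)⁻¹ * (f (z + (n + 1) • h) - f (z + 0 • h)) := by
    simp only [translateAvg]
    rw [← mul_sub, ← Finset.sum_sub_distrib, ← Finset.sum_range_sub (fun k => f (z + k • h))]
    simp only [succ_nsmul, add_assoc]
  rw [h1, abs_mul, abs_of_pos (inv_pos.2 hn), mul_comm]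
  gcongr
  refine (abs_sub _ _).trans ?_
  linarith [hC (z + (n + 1) • h), hC (z + 0 • h)]

/-- Composing with averages along a new element keeps the earlier invariances, because translations
commute. -/
theorem exists_mean_invariantUnder_finset (S : Finset X) :
    ∃ m : (X → ℝ) → ℝ, IsMean m ∧ ∀ h ∈ S, IsInvariantUnder m h := by
  classical
  induction S using Finset.induction_on with
  | empty => exact ⟨_, IsMean.eval 0, by simp⟩
  | insert h S _ ih =>
    obtain ⟨m, hm, hmS⟩ := ih
    obtain ⟨M, hM, hlim⟩ := IsMean.exists_ultralimit (hyperfilter ℕ) (hm.comp_translateAvg h)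
    refine ⟨M, hM, fun g hg f hf => ?_⟩
    have hfg : IsBoundedFun (fun z => f (z + g)) := hf.comp _
    rcases Finset.mem_insert.1 hg with rfl | hg
    · obtain ⟨C, hC⟩ := id hf
      have h1 := (hlim _ hfg).sub (hlim _ hf)
      have h2 : Tendsto (fun n : ℕ => 2 * C * ((n : ℝ) + 1)⁻¹) (hyperfilter ℕ : Filter ℕ)
          (𝓝 (2 * C * 0)) := by
        refine (Tendsto.const_mul _ ?_).mono_left (Nat.hyperfilter_le_atTop)
        simpa only [one_div] using tendsto_one_div_add_atTop_nhds_zero_nat (𝕜 := ℝ)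
      rw [mul_zero] at h2
      have h3 : Tendsto (fun n => m (translateAvg g n fun z => f (z + g)) - m (translateAvg g n f))
          (hyperfilter ℕ : Filter ℕ) (𝓝 0) := squeeze_zero_norm (fun n => by
        rw [← hm.sub (hfg.translateAvg g n) (hf.translateAvg g n)]
        exact hm.abs_le_const (abs_translateAvg_sub_le g n hC)) h2
      exact sub_eq_zero.1 (tendsto_nhds_unique h1 h3)
    · refine tendsto_nhds_unique (hlim _ hfg) ((hlim _ hf).congr fun n => ?_)
      rw [translateAvg_translate]
      exact (hmS g hg _ (hf.translateAvg h n)).symm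

/-- Commutative groups are amenable. -/
theorem exists_invariant_mean (X : Type*) [AddCommGroup X] :
    ∃ m : (X → ℝ) → ℝ, IsMean m ∧ ∀ h, IsInvariantUnder m h := by
  classical
  choose A hA hAS using exists_mean_invariantUnder_finset (X := X)
  -- Along this ultrafilter a finite set eventually contains any given element.
  obtain ⟨m, hm, hlim⟩ := IsMean.exists_ultralimit (Ultrafilter.of (atTop : Filter (Finset X))) hA
  refine ⟨m, hm, fun h f hf => ?_⟩
  refine tendsto_nhds_unique (hlim _ (hf.comp _)) ((hlim _ hf).congr' ?_)
  have : ∀ᶠ S : Finset X in Ultrafilter.of (atTop : Filter (Finset X)), {h} ⊆ S :=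
    (eventually_ge_atTop ({h} : Finset X)).filter_mono (Ultrafilter.of_le _)
  filter_upwards [this] with S hS
  exact (hAS S h (Finset.singleton_subset_iff.1 hS) f hf).symm

end Invariant

/-! ### Function spaces normed by a mean -/

section MeanSpace

/-- The space of bounded functions from `I` to `Y`. -/
def boundedFunctions (I : Type*) (Y : Type*) [SeminormedAddCommGroup Y] [NormedSpace ℝ Y] :
    Submodule ℝ (I → Y) where
  carrier := {g | IsBoundedFun fun i => ‖g i‖}
  add_mem' := by
    rintro f g ⟨C, hC⟩ ⟨D, hD⟩
    simp only [abs_norm] at hC hD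
    refine ⟨C + D, fun i => ?_⟩
    rw [abs_norm]
    exact (norm_add_le _ _).trans (add_le_add (hC i) (hD i))
  zero_mem' := ⟨0, by simp⟩
  smul_mem' := by
    rintro c f ⟨C, hC⟩
    simp only [abs_norm] at hC
    refine ⟨|c| * C, fun i => ?_⟩
    rw [abs_norm, Pi.smul_apply, norm_smul, Real.norm_eq_abs]
    exact mul_le_mul_of_nonneg_left (hC i) (abs_nonneg c)

variable {I : Type u} {m : (I → ℝ) → ℝ}

/-- The space of bounded functions from `I` to `Y` with the seminorm given by the mean of the norm. -/
def MeanSpace (Y : Type v) [SeminormedAddCommGroup Y] [NormedSpace ℝ Y] (_ : IsMean m) :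
    Type (max u v) := boundedFunctions I Y

namespace MeanSpace

variable {Y : Type v} [SeminormedAddCommGroup Y] [NormedSpace ℝ Y] (hm : IsMean m)

instance : AddCommGroup (MeanSpace Y hm) := inferInstanceAs (AddCommGroup (boundedFunctions I Y))

instance : Module ℝ (MeanSpace Y hm) := inferInstanceAs (Module ℝ (boundedFunctions I Y))

variable {hm}

/-- The value of an element of `MeanSpace` at a point. -/
def val (g : MeanSpace Y hm) (i : I) : Y := g.1 i

theorem isBoundedFun (g : MeanSpace Y hm) : IsBoundedFun fun i => ‖g.val i‖ := g.2

/-- A bounded function as an element of `MeanSpace`. -/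
def mk (hm : IsMean m) (g : I → Y) (hg : IsBoundedFun fun i => ‖g i‖) : MeanSpace Y hm := ⟨g, hg⟩

@[simp] theorem val_zero (i : I) : (0 : MeanSpace Y hm).val i = 0 := rfl

@[simp] theorem val_neg (f : MeanSpace Y hm) (i : I) : (-f).val i = -f.val i := rfl

@[simp] theorem val_sub (f g : MeanSpace Y hm) (i : I) : (f - g).val i = f.val i - g.val i := rfl

@[simp] theorem val_smul (c : ℝ) (f : MeanSpace Y hm) (i : I) : (c • f).val i = c • f.val i := rfl

/-- Evaluation at a point, as a linear map. -/
def evalHom (hm : IsMean m) (i : I) : MeanSpace Y hm →ₗ[ℝ] Y where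
  toFun g := g.val i
  map_add' _ _ := rfl
  map_smul' _ _ := rfl

variable (hm)

/-- The mean of the norm, as a seminorm. -/
def addGroupSeminorm : AddGroupSeminorm (MeanSpace Y hm) where
  toFun g := m fun i => ‖g.val i‖
  map_zero' := by simp [hm.const]
  add_le' f g := by
    rw [← hm.add _ _ f.isBoundedFun g.isBoundedFun]
    exact hm.mono _ _ (f + g).isBoundedFun (f.isBoundedFun.add g.isBoundedFun)
      fun i => norm_add_le _ _
  neg' f := by simp

instance : SeminormedAddCommGroup (MeanSpace Y hm) :=
  (addGroupSeminorm hm).toSeminormedAddCommGroup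

variable {hm}

theorem norm_eq (g : MeanSpace Y hm) : ‖g‖ = m fun i => ‖g.val i‖ := rfl

instance : NormedSpace ℝ (MeanSpace Y hm) where
  norm_smul_le c g := by
    rw [norm_eq, norm_eq]
    simp only [val_smul, norm_smul]
    rw [hm.mul _ _ g.isBoundedFun]

theorem isBoundedFun_normDefect (f g : MeanSpace Y hm) :
    IsBoundedFun fun i => normDefect (f.val i) (g.val i) := by
  obtain ⟨C, hC⟩ := f.isBoundedFun
  refine ⟨2 * C, fun i => (abs_normDefect_le_left _ _).trans ?_⟩
  have := hC i
  rw [abs_norm] at this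
  linarith

theorem normDefect_eq (f g : MeanSpace Y hm) :
    normDefect f g = m fun i => normDefect (f.val i) (g.val i) := by
  have h1 := (f - g).isBoundedFun
  simp only [normDefect, norm_eq]
  rw [hm.sub (f := fun i => ‖f.val i - g.val i‖ - ‖f.val i‖) ?_ g.isBoundedFun,
    hm.sub (f := fun i => ‖f.val i - g.val i‖) h1 f.isBoundedFun]
  · rfl
  · convert h1.add (f.isBoundedFun.mul_left (-1)) using 2
    rw [val_sub]
    ring

theorem isBoundedFun_penalizedDefect (η : ℝ) (e : Bool) (f g : MeanSpace Y hm) :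
    IsBoundedFun fun i => penalizedDefect η e (f.val i) (g.val i) := by
  convert (((isBoundedFun_normDefect f g).mul_left (boolSign e)).add
    (f.isBoundedFun.mul_left (-η))).add (g.isBoundedFun.mul_left (-η)) using 2
  unfold penalizedDefect
  ring

/-- The cost is a linear combination of three norms, and each norm is a mean of pointwise norms. The
signs do not matter, so no convexity is involved. -/
theorem penalizedDefect_eq (η : ℝ) (e : Bool) (f g : MeanSpace Y hm) :
    penalizedDefect η e f g = m fun i => penalizedDefect η e (f.val i) (g.val i) := by
  have h1 := (isBoundedFun_normDefect f g).mul_left (boolSign e)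
  have h2 := f.isBoundedFun.mul_left (-η)
  have h3 := g.isBoundedFun.mul_left (-η)
  calc penalizedDefect η e f g = (boolSign e * m (fun i => normDefect (f.val i) (g.val i)) +
        -η * m (fun i => ‖f.val i‖)) + -η * m fun i => ‖g.val i‖ := by
        rw [← normDefect_eq f g, ← norm_eq f, ← norm_eq g]
        unfold penalizedDefect
        ring
    _ = _ := by
        rw [← hm.mul _ _ (isBoundedFun_normDefect f g), ← hm.mul _ _ f.isBoundedFun,
          ← hm.mul _ _ g.isBoundedFun, ← hm.add _ _ h1 h2, ← hm.add _ _ (h1.add h2) h3]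
        congr 1
        funext i
        unfold penalizedDefect
        ring

theorem pathSum_eq (η : ℝ) (b : List Bool → MeanSpace Y hm) (x : MeanSpace Y hm) (l : List Bool) :
    (IsBoundedFun fun i => pathSum (penalizedDefect η) (fun k => (b k).val i) (x.val i) l) ∧
    pathSum (penalizedDefect η) b x l =
      m fun i => pathSum (penalizedDefect η) (fun k => (b k).val i) (x.val i) l := by
  induction l generalizing b with
  | nil => exact ⟨IsBoundedFun.const 0, (hm.const 0).symm⟩
  | cons e l ih =>
    obtain ⟨h1, h2⟩ := ih (fun k => b (e :: k))
    have h3 := isBoundedFun_penalizedDefect η e x (b [])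
    refine ⟨h3.add h1, ?_⟩
    simp only [pathSum]
    rw [hm.add _ _ h3 h1, ← h2, penalizedDefect_eq]

theorem pathAvg_eq (n : ℕ) (Ψ : List Bool → I → ℝ) (hΨ : ∀ l, IsBoundedFun (Ψ l)) (hm : IsMean m) :
    (IsBoundedFun fun i => pathAvg n fun l => Ψ l i) ∧
    (pathAvg n fun l => m (Ψ l)) = m fun i => pathAvg n fun l => Ψ l i := by
  induction n generalizing Ψ with
  | zero => exact ⟨hΨ [], rfl⟩
  | succ n ih =>
    obtain ⟨a1, a2⟩ := ih (fun l => Ψ (false :: l)) (fun l => hΨ _)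
    obtain ⟨b1, b2⟩ := ih (fun l => Ψ (true :: l)) (fun l => hΨ _)
    have h : (fun i => pathAvg (n + 1) fun l => Ψ l i) = fun i =>
        2⁻¹ * ((pathAvg n fun l => Ψ (false :: l) i) + pathAvg n fun l => Ψ (true :: l) i) := by
      funext i
      simp only [pathAvg]
      ring
    rw [h]
    refine ⟨(a1.add b1).mul_left _, ?_⟩
    rw [hm.mul _ _ (a1.add b1), hm.add _ _ a1 b1, ← a2, ← b2]
    simp only [pathAvg]
    ring

/-- Defect bounds pass from `Y` to spaces of bounded functions with the mean of the norm. -/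
theorem defectBound {η : ℝ} {n : ℕ} (h : DefectBound Y η n) : DefectBound (MeanSpace Y hm) η n := by
  intro b x
  simp only [fun l => (pathSum_eq η b (x l) l).2]
  obtain ⟨h1, h2⟩ := pathAvg_eq n
    (fun l i => pathSum (penalizedDefect η) (fun k => (b k).val i) ((x l).val i) l)
    (fun l => (pathSum_eq η b (x l) l).1) hm
  rw [h2]
  exact hm.le_const h1 fun i => h _ _

end MeanSpace

end MeanSpace

/-! ### Ladders, instability and superstability -/

section NormLadder

/-- A ladder of length `n` of elements of norm at most `R`, with respect to `‖x - y‖ - ‖x‖`. -/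
def HasNormLadder (V : Type*) [SeminormedAddCommGroup V] (R α β : ℝ) (n : ℕ) : Prop :=
  ∃ x y : ℕ → V, (∀ i < n, ‖x i‖ ≤ R ∧ ‖y i‖ ≤ R) ∧ ∀ i < n, ∀ j < n,
    (i < j → ‖x i - y j‖ - ‖x i‖ ≤ α) ∧ (j ≤ i → β ≤ ‖x i - y j‖ - ‖x i‖)

/-- In the binary search tree of a ladder the sign agrees with the side of the gap, so each node
gains about `(β - α) / 2`. What remains is a sign times a quantity known at the node, and this
averages to zero. The norm of the leaf is not known there, which is why ladders are formed with `‖x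
- y‖ - ‖x‖`. -/
theorem DefectBound.not_hasNormLadder {V : Type*} [SeminormedAddCommGroup V] {η R α β : ℝ} {n : ℕ}
    (hη : 0 ≤ η) (hn : 0 < n) (h : DefectBound V η n) (hgap : 4 * η * R < β - α) :
    ¬ HasNormLadder V R α β (2 ^ n) := by
  rintro ⟨x, y, hR, hlad⟩
  set γ := (β - α) / 2 - 2 * η * R with hγ
  have hγ0 : 0 < γ := by rw [hγ]; linarith
  obtain ⟨b, k, -, hbk⟩ := exists_tree_of_ladder n x y (penalizedDefect η)
    (fun e _ y => boolSign e * ((α + β) / 2 - ‖y‖) + γ) 0 (fun i j _ hi _ hj => by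
      rw [zero_add] at hi hj
      have h1 : η * ‖x i‖ ≤ η * R := mul_le_mul_of_nonneg_left (hR i hi).1 hη
      have h2 : η * ‖y j‖ ≤ η * R := mul_le_mul_of_nonneg_left (hR j hj).2 hη
      have h3 := hlad i hi j hj
      constructor
      · intro hij
        have := h3.2 hij
        simp only [penalizedDefect, boolSign_true, normDefect]
        linarith
      · intro hij
        have := h3.1 hij
        simp only [penalizedDefect, boolSign_false, normDefect]
        linarith)
  have h1 := (pathAvg_mono hbk).trans (h b fun l => x (k l))
  have h2 : pathAvg n (fun l => pathSum (fun e (_ : V) y =>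
      boolSign e * ((α + β) / 2 - ‖y‖) + γ) b (x (k l)) l) = n * γ := by
    calc _ = pathAvg n (fun l => pathSum (fun e (_ : V) y =>
          boolSign e * ((α + β) / 2 - ‖y‖)) b (x (k l)) l) +
          pathAvg n (fun l => pathSum (fun _ (_ : V) _ => γ) b (x (k l)) l) := by
          rw [← pathAvg_add]
          simp only [pathSum_add]
      _ = 0 + n * γ := by
          congr 1
          · exact pathAvg_pathSum_boolSign n (fun y : V => (α + β) / 2 - ‖y‖) b (fun l => x (k l))
          · refine le_antisymm (pathAvg_le fun l hl => ?_) (le_pathAvg fun l hl => ?_) <;>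
              rw [pathSum_left (fun _ => γ), hl]
      _ = _ := zero_add _
  rw [h2] at h1
  have : 0 < (n : ℝ) * γ := by positivity
  linarith

theorem HasNormLadder.of_approx {V W : Type*} [SeminormedAddCommGroup V] [SeminormedAddCommGroup W]
    {R α β ε : ℝ} {n : ℕ} (h : HasNormLadder W R α β n)
    (happ : ∀ x y : ℕ → W, (∀ i < n, ‖x i‖ ≤ R ∧ ‖y i‖ ≤ R) → ∃ x' y' : ℕ → V, ∀ i < n, ∀ j < n,
      |‖x' i‖ - ‖x i‖| ≤ ε ∧ |‖y' i‖ - ‖y i‖| ≤ ε ∧ |‖x' i - y' j‖ - ‖x i - y j‖| ≤ ε) :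
    HasNormLadder V (R + ε) (α + 2 * ε) (β - 2 * ε) n := by
  obtain ⟨x, y, hR, hlad⟩ := h
  obtain ⟨x', y', h'⟩ := happ x y hR
  refine ⟨x', y', fun i hi => ?_, fun i hi j hj => ?_⟩
  · obtain ⟨h1, h2, -⟩ := h' i hi i hi
    have := hR i hi
    rw [abs_le] at h1 h2
    constructor <;> linarith
  · obtain ⟨h1, -, h3⟩ := h' i hi j hj
    have := hlad i hi j hj
    rw [abs_le] at h1 h3
    exact ⟨fun h => by linarith [this.1 h], fun h => by linarith [this.2 h]⟩

theorem HasNormLadder.of_completion {V : Type*} [SeminormedAddCommGroup V] {R α β ε : ℝ} {n : ℕ}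
    (hε : 0 < ε) (h : HasNormLadder (UniformSpace.Completion V) R α β n) :
    HasNormLadder V (R + ε) (α + 2 * ε) (β - 2 * ε) n := by
  refine h.of_approx fun x y _ => ?_
  have hd : ∀ w : UniformSpace.Completion V, ∃ z : V, ‖w - z‖ < ε / 2 := fun w => by
    obtain ⟨z, hz⟩ := UniformSpace.Completion.denseRange_coe.exists_dist_lt w (half_pos hε)
    exact ⟨z, by rwa [← dist_eq_norm]⟩
  choose z hz using hd
  refine ⟨fun i => z (x i), fun i => z (y i), fun i _ j _ => ⟨?_, ?_, ?_⟩⟩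
  · rw [← UniformSpace.Completion.norm_coe, abs_sub_comm]
    exact (abs_norm_sub_norm_le _ _).trans (by linarith [hz (x i)])
  · rw [← UniformSpace.Completion.norm_coe, abs_sub_comm]
    exact (abs_norm_sub_norm_le _ _).trans (by linarith [hz (y i)])
  · rw [← UniformSpace.Completion.norm_coe, UniformSpace.Completion.coe_sub, abs_sub_comm]
    refine (abs_norm_sub_norm_le _ _).trans ?_
    rw [sub_sub_sub_comm]
    refine (norm_sub_le _ _).trans ?_
    linarith [hz (x i), hz (y j)]

theorem IsFinitelyRepresentable.hasNormLadder {W Z : Type*} [NormedAddCommGroup W]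
    [NormedSpace ℝ W] [NormedAddCommGroup Z] [NormedSpace ℝ Z] (hWZ : IsFinitelyRepresentable W Z)
    {R α β ε : ℝ} {n : ℕ} (hR : 0 ≤ R) (hε : 0 < ε) (h : HasNormLadder W R α β n) :
    HasNormLadder Z (R + ε) (α + 2 * ε) (β - 2 * ε) n := by
  refine h.of_approx fun x y hxy => ?_
  set E : Submodule ℝ W := Submodule.span ℝ
    ((x '' Set.Iio n) ∪ (y '' Set.Iio n)) with hE
  have hfin : FiniteDimensional ℝ E := FiniteDimensional.span_of_finite ℝ
    (((Set.finite_Iio n).image x).union ((Set.finite_Iio n).image y))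
  have hxE : ∀ i < n, x i ∈ E := fun i hi => Submodule.subset_span (Or.inl ⟨i, hi, rfl⟩)
  have hyE : ∀ i < n, y i ∈ E := fun i hi => Submodule.subset_span (Or.inr ⟨i, hi, rfl⟩)
  set ε' := ε / (2 * R + 1) with hε'
  have hε'0 : 0 < ε' := by positivity
  obtain ⟨F, T, hT⟩ := hWZ E hfin ε' hε'0
  set c := ‖(T.symm : F →L[ℝ] E)‖ with hc
  -- Rescaling by the norm of the inverse gives `‖w‖ ≤ ‖S w‖ ≤ (1 + ε') * ‖w‖`.
  set S : E → Z := fun w => c • (T w : Z) with hS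
  have hSsub : ∀ w w', S w - S w' = S (w - w') := fun w w' => by
    simp [hS, smul_sub]
  have hSn : ∀ w : E, ‖w‖ ≤ 2 * R → |‖S w‖ - ‖w‖| ≤ ε := by
    intro w hw
    have e1 : ‖S w‖ = c * ‖T w‖ := by
      simp only [hS, norm_smul, Real.norm_of_nonneg (norm_nonneg (T.symm : F →L[ℝ] E)), hc]
      rfl
    have h1 : ‖w‖ ≤ c * ‖T w‖ := by
      simpa using (T.symm : F →L[ℝ] E).le_opNorm (T w)
    have h2 : c * ‖T w‖ ≤ (1 + ε') * ‖w‖ := by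
      have h3 : ‖T w‖ ≤ ‖(T : E →L[ℝ] F)‖ * ‖w‖ := (T : E →L[ℝ] F).le_opNorm w
      calc c * ‖T w‖ ≤ c * (‖(T : E →L[ℝ] F)‖ * ‖w‖) := by gcongr
        _ = (‖(T : E →L[ℝ] F)‖ * c) * ‖w‖ := by ring
        _ ≤ _ := by gcongr
    have h4 : ε' * ‖w‖ ≤ ε := by
      calc ε' * ‖w‖ ≤ ε' * (2 * R + 1) := by gcongr; linarith
        _ = ε := by rw [hε']; field_simp
    rw [e1, abs_le]
    constructor <;> linarith
  classical
  refine ⟨fun i => if hi : i < n then S ⟨x i, hxE i hi⟩ else 0,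
    fun i => if hi : i < n then S ⟨y i, hyE i hi⟩ else 0, fun i hi j hj => ⟨?_, ?_, ?_⟩⟩
  · simp only [dif_pos hi]
    refine hSn ⟨x i, hxE i hi⟩ ?_
    have := (hxy i hi).1
    change ‖x i‖ ≤ _
    linarith
  · simp only [dif_pos hi]
    refine hSn ⟨y i, hyE i hi⟩ ?_
    have := (hxy i hi).2
    change ‖y i‖ ≤ _
    linarith
  · simp only [dif_pos hi, dif_pos hj, hSsub]
    refine hSn (⟨x i, hxE i hi⟩ - ⟨y j, hyE j hj⟩) ?_
    have h1 := (hxy i hi).1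
    have h2 := (hxy j hj).2
    change ‖x i - y j‖ ≤ _
    linarith [norm_sub_le (x i) (y j)]

/-- A pair of sequences with different iterated limits contains long ladders. -/
theorem exists_ladder_of_iterated_limits {A B : Type*} (θ : A → B → ℝ) (x : ℕ → A) (y : ℕ → B)
    (U V : Ultrafilter ℕ) {g h : ℕ → ℝ} {a b α β : ℝ}
    (hg : ∀ i, Tendsto (fun j => θ (x i) (y j)) V (𝓝 (g i))) (ha : Tendsto g U (𝓝 a))
    (hh : ∀ j, Tendsto (fun i => θ (x i) (y j)) U (𝓝 (h j))) (hb : Tendsto h V (𝓝 b))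
    (haα : a < α) (hβb : β < b) (n : ℕ) :
    ∃ k l : ℕ → ℕ, (∀ i < n, g (k i) < α ∧ β < h (l i)) ∧ ∀ i < n, ∀ j < n,
      (i < j → θ (x (k i)) (y (l j)) ≤ α) ∧ (j ≤ i → β ≤ θ (x (k i)) (y (l j))) := by
  induction n with
  | zero => exact ⟨id, id, by simp, by simp⟩
  | succ n ih =>
    obtain ⟨k, l, h1, h2⟩ := ih
    -- The new `q` is chosen before the new `p`, so that the diagonal pair falls on the `β` side.
    -- The strict bounds on the inner limits keep the construction going.
    have hl : ∀ᶠ q in (V : Filter ℕ), β < h q ∧ ∀ i ∈ Finset.range n, θ (x (k i)) (y q) < α := by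
      refine (hb.eventually_const_lt hβb).and ((Filter.eventually_all_finset _).2 fun i hi => ?_)
      exact (hg (k i)).eventually_lt_const (h1 i (Finset.mem_range.1 hi)).1
    obtain ⟨q, hq, hqk⟩ := hl.exists
    have hk : ∀ᶠ p in (U : Filter ℕ), g p < α ∧ β < θ (x p) (y q) ∧
        ∀ j ∈ Finset.range n, β < θ (x p) (y (l j)) := by
      refine (ha.eventually_lt_const haα).and (((hh q).eventually_const_lt hq).and
        ((Filter.eventually_all_finset _).2 fun j hj => ?_))
      exact (hh (l j)).eventually_const_lt (h1 j (Finset.mem_range.1 hj)).2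
    obtain ⟨p, hp, hpq, hpl⟩ := hk.exists
    refine ⟨Function.update k n p, Function.update l n q, fun i hi => ?_, fun i hi j hj => ?_⟩
    · rcases Nat.lt_succ_iff_lt_or_eq.1 hi with hi | rfl
      · rw [Function.update_of_ne hi.ne, Function.update_of_ne hi.ne]
        exact h1 i hi
      · simp only [Function.update_self]
        exact ⟨hp, hq⟩
    · rcases Nat.lt_succ_iff_lt_or_eq.1 hi with hi | rfl <;>
        rcases Nat.lt_succ_iff_lt_or_eq.1 hj with hj | rfl
      · rw [Function.update_of_ne hi.ne, Function.update_of_ne hj.ne]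
        exact h2 i hi j hj
      · rw [Function.update_of_ne hi.ne, Function.update_self]
        exact ⟨fun _ => (hqk i (Finset.mem_range.2 hi)).le, fun h => absurd h (by omega)⟩
      · rw [Function.update_of_ne hj.ne, Function.update_self]
        exact ⟨fun h => absurd h (by omega), fun _ => (hpl j (Finset.mem_range.2 hj)).le⟩
      · simp only [Function.update_self]
        exact ⟨fun h => absurd h (lt_irrefl _), fun _ => hpq.le⟩

/-- Subtracting `‖x i‖`, which converges along `U`, shifts both iterated limits by the same amount
and so preserves the gap. -/
theorem hasNormLadder_of_iterated_limits {W : Type*} [SeminormedAddCommGroup W] (x y : ℕ → W)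
    {R : ℝ} (hx : ∀ i, ‖x i‖ ≤ R) (hy : ∀ i, ‖y i‖ ≤ R)
    (U V : Ultrafilter ℕ) {g h : ℕ → ℝ} {a b : ℝ}
    (hg : ∀ i, Tendsto (fun j => dist (x i) (y j)) V (𝓝 (g i))) (ha : Tendsto g U (𝓝 a))
    (hh : ∀ j, Tendsto (fun i => dist (x i) (y j)) U (𝓝 (h j))) (hb : Tendsto h V (𝓝 b))
    (hab : a < b) : ∃ α β, α < β ∧ ∀ n, HasNormLadder W R α β n := by
  obtain ⟨c, hc⟩ := IsBoundedFun.exists_tendsto (f := fun i => ‖x i‖)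
    ⟨R, fun i => by rw [abs_norm]; exact hx i⟩ U
  refine ⟨a - c + (b - a) / 3, b - c - (b - a) / 3, by linarith, fun n => ?_⟩
  obtain ⟨k, l, -, hkl⟩ := exists_ladder_of_iterated_limits (fun x y => ‖x - y‖ - ‖x‖) x y U V
    (g := fun i => g i - ‖x i‖) (h := fun j => h j - c) (a := a - c) (b := b - c)
    (α := a - c + (b - a) / 3) (β := b - c - (b - a) / 3)
    (fun i => ((hg i).congr fun j => dist_eq_norm _ _).sub_const _) (ha.sub hc)
    (fun j => ((hh j).congr fun i => dist_eq_norm _ _).sub hc) (hb.sub_const _)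
    (by linarith) (by linarith) n
  exact ⟨fun i => x (k i), fun i => y (l i), fun i _ => ⟨hx _, hy _⟩, hkl⟩

theorem exists_hasNormLadder_of_not_stable {W : Type*} [NormedAddCommGroup W]
    (h : ¬ IsStableSpace W) :
    ∃ R α β : ℝ, 0 ≤ R ∧ α < β ∧ ∀ n, HasNormLadder W R α β n := by
  unfold IsStableSpace at h
  push Not at h
  obtain ⟨x, y, hx, hy, U, V, -, -, g, h, a, b, hg, ha, hh, hb, hab⟩ := h
  obtain ⟨R₁, hR₁⟩ := hx.exists_norm_le
  obtain ⟨R₂, hR₂⟩ := hy.exists_norm_le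
  have hx' : ∀ i, ‖x i‖ ≤ max R₁ R₂ := fun i => (hR₁ _ ⟨i, rfl⟩).trans (le_max_left _ _)
  have hy' : ∀ i, ‖y i‖ ≤ max R₁ R₂ := fun i => (hR₂ _ ⟨i, rfl⟩).trans (le_max_right _ _)
  have hR : 0 ≤ max R₁ R₂ := (norm_nonneg _).trans (hx' 0)
  rcases lt_or_gt_of_ne hab with hab | hab
  · obtain ⟨α, β, h1, h2⟩ := hasNormLadder_of_iterated_limits x y hx' hy' U V hg ha hh hb hab
    exact ⟨_, α, β, hR, h1, h2⟩
  -- The opposite inequality is reduced to the first case by exchanging the two sequences.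
  · simp only [dist_comm (x _) (y _)] at hg hh
    obtain ⟨α, β, h1, h2⟩ := hasNormLadder_of_iterated_limits y x hy' hx' V U hh hb hg ha hab
    exact ⟨_, α, β, hR, h1, h2⟩

/-- Defect bounds in `Y` for all penalties make the completion of `MeanSpace Y` superstable. -/
theorem isSuperstable_completion_meanSpace {I : Type u} {m : (I → ℝ) → ℝ} (hm : IsMean m)
    {Y : Type v} [SeminormedAddCommGroup Y] [NormedSpace ℝ Y]
    (hY : ∀ η : ℝ, 0 < η → ∃ N, 0 < N ∧ DefectBound Y η N) :
    IsSuperstable.{max u v, w} (UniformSpace.Completion (MeanSpace Y hm)) := by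
  intro W _ _ _ hW
  by_contra hst
  obtain ⟨R, α, β, hR, hαβ, hlad⟩ := exists_hasNormLadder_of_not_stable hst
  -- Two approximations, to the completion and then to the space itself, cost `4 * ε` of the gap
  -- each. The remaining `8 * ε` exceeds `4 * η * (R + 2 * ε) = 4 * ε`.
  set ε := (β - α) / 16 with hε
  have hε0 : 0 < ε := by rw [hε]; linarith
  set η := ε / (R + 2 * ε) with hη
  have hη0 : 0 < η := by positivity
  obtain ⟨N, hN0, hN⟩ := hY η hη0
  refine DefectBound.not_hasNormLadder hη0.le hN0 (MeanSpace.defectBound (hm := hm) hN) ?_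
    ((hW.hasNormLadder hR hε0 (hlad (2 ^ N))).of_completion hε0)
  have : 4 * η * (R + ε + ε) = 4 * ε := by
    rw [hη]
    field_simp
    ring
  rw [this]
  linarith

end NormLadder

/-! ### Ultrapowers and the failure of shattering -/

/-- The space of bounded functions with the norm given by the limit of the norms along an
ultrafilter is finitely representable in `Y`. -/
theorem isFinitelyRepresentable_completion_meanSpace {I : Type u} {m : (I → ℝ) → ℝ} (hm : IsMean m)
    (U : Ultrafilter I) (hlim : ∀ f, IsBoundedFun f → Tendsto f U (𝓝 (m f)))
    (Y : Type v) [NormedAddCommGroup Y] [NormedSpace ℝ Y] :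
    IsFinitelyRepresentable (UniformSpace.Completion (MeanSpace Y hm)) Y := by
  intro E hE ε hε
  set κ := min (1 / 2) (ε / 8) with hκ
  have hκ0 : 0 < κ := by positivity
  have hκ1 : κ ≤ 1 / 2 := min_le_left _ _
  have hκ2 : κ ≤ ε / 8 := min_le_right _ _
  set e := Module.finBasis ℝ E
  set d := Module.finrank ℝ E
  set C := ‖LinearMap.toContinuousLinearMap (e.equivFun : E →ₗ[ℝ] (Fin d → ℝ))‖
  have hC : ∀ (x : E) i, |e.repr x i| ≤ C * ‖x‖ := fun x i =>
    (norm_le_pi_norm (e.equivFun x) i).trans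
      ((LinearMap.toContinuousLinearMap (e.equivFun : E →ₗ[ℝ] (Fin d → ℝ))).le_opNorm x)
  have hC0 : 0 ≤ C := ContinuousLinearMap.opNorm_nonneg _
  -- Moving each basis vector by less than `τ` changes the norm by a factor within `κ / 2` of one,
  -- as coordinates are at most `C * ‖x‖`.
  set τ := κ / (2 * (d * C + 1)) with hτ
  have hτ0 : 0 < τ := by positivity
  have happ : ∀ i, ∃ z : MeanSpace Y hm,
      ‖(z : UniformSpace.Completion (MeanSpace Y hm)) - e i‖ < τ := fun i => by
    obtain ⟨z, hz⟩ := UniformSpace.Completion.denseRange_coe.exists_dist_lt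
      (e i : UniformSpace.Completion (MeanSpace Y hm)) hτ0
    exact ⟨z, by rwa [← dist_eq_norm, dist_comm]⟩
  choose z hz using happ
  set L : E →ₗ[ℝ] MeanSpace Y hm := e.constr ℝ z
  have hL : ∀ x : E, L x = ∑ i, e.repr x i • z i := fun x => by
    simp only [L, Module.Basis.constr_apply_fintype, Module.Basis.equivFun_apply]
  have hLx : ∀ x : E, |‖L x‖ - ‖x‖| ≤ κ / 2 * ‖x‖ := by
    intro x
    have h1 : ((L x : MeanSpace Y hm) : UniformSpace.Completion (MeanSpace Y hm)) - (x : E) =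
        ∑ i, e.repr x i • ((z i : UniformSpace.Completion (MeanSpace Y hm)) - e i) := by
      have h2 : (x : UniformSpace.Completion (MeanSpace Y hm)) =
          ∑ i, e.repr x i • (e i : UniformSpace.Completion (MeanSpace Y hm)) := by
        have h := congrArg E.subtype (e.sum_repr x).symm
        rw [map_sum] at h
        exact h
      rw [hL]
      conv_lhs => rw [h2]
      simp only [smul_sub, Finset.sum_sub_distrib]
      congr 1
      have := map_sum (UniformSpace.Completion.toComplₗᵢ (𝕜 := ℝ) (E := MeanSpace Y hm))
        (fun i => e.repr x i • z i) Finset.univ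
      exact this.trans (Finset.sum_congr rfl fun i _ => UniformSpace.Completion.coe_smul _ _)
    have h3 : ‖((L x : MeanSpace Y hm) : UniformSpace.Completion (MeanSpace Y hm)) - (x : E)‖ ≤
        κ / 2 * ‖x‖ := by
      rw [h1]
      calc _ ≤ ∑ i : Fin d, C * ‖x‖ * τ := by
            refine norm_sum_le_of_le _ fun i _ => ?_
            rw [norm_smul]
            exact mul_le_mul (hC x i) (hz i).le (norm_nonneg _) (by positivity)
        _ = (d * C * τ) * ‖x‖ := by simp; ring
        _ ≤ κ / 2 * ‖x‖ := by
            gcongr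
            rw [hτ, mul_div_assoc', div_le_div_iff₀ (by positivity) two_pos]
            nlinarith
    have h4 := abs_norm_sub_norm_le
      ((L x : MeanSpace Y hm) : UniformSpace.Completion (MeanSpace Y hm)) (x : E)
    rw [UniformSpace.Completion.norm_coe] at h4
    exact h4.trans h3
  set T : I → E →ₗ[ℝ] Y := fun N => MeanSpace.evalHom hm N ∘ₗ L
  have hTlim : ∀ x, Tendsto (fun N => ‖T N x‖) U (𝓝 ‖L x‖) := fun x => hlim _ (L x).isBoundedFun
  choose B hB using fun i => (z i).isBoundedFun
  have hTbd : ∀ N x, ‖T N x‖ ≤ (C * ∑ i, B i) * ‖x‖ := by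
    intro N x
    have h1 : T N x = ∑ i, e.repr x i • (z i).val N := by
      change MeanSpace.evalHom hm N (L x) = _
      rw [hL, map_sum]
      rfl
    rw [h1, Finset.mul_sum, Finset.sum_mul]
    refine norm_sum_le_of_le _ fun i _ => ?_
    have h2 := hB i N
    rw [abs_norm] at h2
    rw [norm_smul]
    calc _ ≤ (C * ‖x‖) * B i := mul_le_mul (hC x i) h2 (norm_nonneg _) (by positivity)
      _ = _ := by ring
  have hprop : ProperSpace E := FiniteDimensional.proper_real E
  -- Pointwise convergence of the norms becomes uniform on the compact sphere, because the maps `T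
  -- N` are uniformly Lipschitz.
  have hex : ∃ N, ∀ x ∈ Metric.sphere (0 : E) 1, |‖T N x‖ - 1| ≤ κ := by
    by_contra hcon
    push Not at hcon
    choose x hx hxκ using hcon
    obtain ⟨x₀, hx₀, hx₀lim⟩ := (isCompact_sphere (0 : E) 1).ultrafilter_le_nhds' (U.map x)
      (Ultrafilter.mem_map.2 (Filter.mem_of_superset Filter.univ_mem fun i _ => hx i))
    have hxlim : Tendsto x U (𝓝 x₀) := hx₀lim
    have h1 : Tendsto (fun N => ‖T N (x N)‖ - ‖T N x₀‖) U (𝓝 0) := by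
      have h2 : Tendsto (fun N => (C * ∑ i, B i) * ‖x N - x₀‖) U (𝓝 0) := by
        simpa using (tendsto_iff_norm_sub_tendsto_zero.1 hxlim).const_mul (C * ∑ i, B i)
      refine squeeze_zero_norm (fun N => ?_) h2
      refine (abs_norm_sub_norm_le _ _).trans ?_
      rw [← map_sub]
      exact hTbd N _
    have h2 : Tendsto (fun N => |‖T N (x N)‖ - 1|) U (𝓝 |‖L x₀‖ - 1|) := by
      have := ((h1.add (hTlim x₀)).sub_const 1).abs
      simpa using this
    have h3 := ge_of_tendsto' h2 fun N => (hxκ N).le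
    have h4 := hLx x₀
    rw [mem_sphere_zero_iff_norm.1 hx₀, mul_one] at h4
    linarith
  obtain ⟨N, hN⟩ := hex
  have hTN : ∀ x : E, |‖T N x‖ - ‖x‖| ≤ κ * ‖x‖ := by
    intro x
    rcases eq_or_ne x 0 with rfl | hx
    · simp
    · have hx' : 0 < ‖x‖ := norm_pos_iff.2 hx
      have h1 := hN (‖x‖⁻¹ • x) (by
        rw [mem_sphere_zero_iff_norm, norm_smul, norm_inv, norm_norm, inv_mul_cancel₀ hx'.ne'])
      rw [map_smul, norm_smul, norm_inv, norm_norm] at h1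
      have h2 : ‖x‖⁻¹ * ‖T N x‖ - 1 = ‖x‖⁻¹ * (‖T N x‖ - ‖x‖) := by field_simp
      rwa [h2, abs_mul, abs_of_pos (inv_pos.2 hx'), inv_mul_le_iff₀ hx', mul_comm] at h1
  have hinj : Function.Injective (T N) := by
    refine (injective_iff_map_eq_zero (T N)).2 fun x hx => norm_eq_zero.1 ?_
    have h1 := (abs_le.1 (hTN x)).1
    rw [hx, norm_zero] at h1
    nlinarith [norm_nonneg x]
  set S := (LinearEquiv.ofInjective (T N) hinj).toContinuousLinearEquiv
  have hSn : ∀ x, ‖S x‖ = ‖T N x‖ := fun x => rfl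
  refine ⟨LinearMap.range (T N), S, ?_⟩
  have h1 : ‖(S : E →L[ℝ] LinearMap.range (T N))‖ ≤ 1 + κ := by
    refine ContinuousLinearMap.opNorm_le_bound _ (by positivity) fun x => ?_
    change ‖S x‖ ≤ _
    rw [hSn]
    linarith [(abs_le.1 (hTN x)).2]
  have h2 : ‖(S.symm : LinearMap.range (T N) →L[ℝ] E)‖ ≤ (1 - κ)⁻¹ := by
    refine ContinuousLinearMap.opNorm_le_bound _ (inv_nonneg.2 (by linarith)) fun y => ?_
    change ‖S.symm y‖ ≤ _
    have h3 := (abs_le.1 (hTN (S.symm y))).1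
    rw [← hSn, ContinuousLinearEquiv.apply_symm_apply] at h3
    rw [inv_mul_eq_div, le_div_iff₀ (by linarith)]
    linarith
  calc _ ≤ (1 + κ) * (1 - κ)⁻¹ := by gcongr
    _ < 1 + ε := by
        rw [← div_eq_mul_inv, div_lt_iff₀ (by linarith)]
        nlinarith

/-- In a stable space, the defects of two bounded sequences do not jump at the diagonal. -/
theorem IsStableSpace.not_defect_jump {W : Type*} [NormedAddCommGroup W] (hW : IsStableSpace W)
    {x y : ℕ → W} {R δ σ : ℝ} (hδ : 0 < δ) (hx : ∀ i, ‖x i‖ ≤ R) (hy : ∀ i, ‖y i‖ ≤ R) :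
    ¬ ∀ i j k, i ≤ j → j < k → δ ≤ σ * (normDefect (x i) (y j) - normDefect (x k) (y j)) := by
  intro h
  set U := hyperfilter ℕ
  have hd : ∀ i j, |dist (x i) (y j)| ≤ R + R := fun i j => by
    rw [abs_of_nonneg dist_nonneg, dist_eq_norm]
    exact (norm_sub_le _ _).trans (add_le_add (hx i) (hy j))
  choose g hg using fun i => IsBoundedFun.exists_tendsto (f := fun j => dist (x i) (y j))
    ⟨R + R, fun j => hd i j⟩ U
  choose q hq using fun j => IsBoundedFun.exists_tendsto (f := fun i => dist (x i) (y j))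
    ⟨R + R, fun i => hd i j⟩ U
  obtain ⟨a, ha⟩ := IsBoundedFun.exists_tendsto (f := g)
    ⟨R + R, fun i => le_of_tendsto' (hg i).abs fun j => hd i j⟩ U
  obtain ⟨b, hb⟩ := IsBoundedFun.exists_tendsto (f := q)
    ⟨R + R, fun j => le_of_tendsto' (hq j).abs fun i => hd i j⟩ U
  obtain ⟨c, hc⟩ := IsBoundedFun.exists_tendsto (f := fun i => ‖x i‖)
    ⟨R, fun i => by rw [abs_norm]; exact hx i⟩ U
  have hU : ∀ n : ℕ, U ≠ pure n := fun n hn => by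
    have h1 : ({n} : Set ℕ)ᶜ ∈ U := by
      have := (Set.finite_singleton n).compl_mem_hyperfilter
      exact this
    rw [hn] at h1
    exact h1 rfl
  have hbx : Bornology.IsBounded (Set.range x) :=
    isBounded_iff_forall_norm_le.2 ⟨R, by rintro _ ⟨i, rfl⟩; exact hx i⟩
  have hby : Bornology.IsBounded (Set.range y) :=
    isBounded_iff_forall_norm_le.2 ⟨R, by rintro _ ⟨i, rfl⟩; exact hy i⟩
  have hab := hW x y hbx hby U U hU hU g q a b hg ha hq hb
  have hlarge : ∀ n : ℕ, ∀ᶠ k in (U : Filter ℕ), n < k := fun n =>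
    (eventually_gt_atTop n).filter_mono Nat.hyperfilter_le_atTop
  -- The limits are taken in `k`, then `j`, then `i`, as `i ≤ j < k` demands; the `‖y j‖` cancel.
  -- The two iterated limits of the distance then appear with opposite signs.
  have h1 : ∀ i j, i ≤ j → δ ≤ σ * ((dist (x i) (y j) - ‖x i‖) - (q j - c)) := by
    intro i j hij
    refine ge_of_tendsto (((tendsto_const_nhds (x := dist (x i) (y j) - ‖x i‖)).sub
      ((hq j).sub hc)).const_mul σ) ?_
    filter_upwards [hlarge j] with k hk
    have := h i j k hij hk
    simp only [normDefect] at this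
    simp only [dist_eq_norm]
    linarith
  have h2 : ∀ i, δ ≤ σ * ((g i - ‖x i‖) - (b - c)) := by
    intro i
    refine ge_of_tendsto ((((hg i).sub_const ‖x i‖).sub (hb.sub_const c)).const_mul σ) ?_
    filter_upwards [hlarge i] with j hj
    exact h1 i j hj.le
  have h3 : δ ≤ σ * ((a - c) - (b - c)) :=
    ge_of_tendsto' (((ha.sub hc).sub_const (b - c)).const_mul σ) h2
  rw [hab, sub_self, mul_zero] at h3
  linarith

/-- A superstable space does not contain arbitrarily long finite sequences whose defects jump at the
diagonal. -/
theorem IsSuperstable.exists_not_defect_jump {Y : Type v} [NormedAddCommGroup Y] [NormedSpace ℝ Y]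
    (hY : IsSuperstable.{v, max u v} Y) {R δ : ℝ} (σ : ℝ) (hR : 0 ≤ R) (hδ : 0 < δ) :
    ∃ n : ℕ, ¬ ∃ x y : ℕ → Y, (∀ i < n, ‖x i‖ ≤ R ∧ ‖y i‖ ≤ R) ∧ ∀ i j k, i ≤ j → j < k → k < n →
      δ ≤ σ * (normDefect (x i) (y j) - normDefect (x k) (y j)) := by
  by_contra hcon
  push Not at hcon
  choose x y hxy h using hcon
  -- The lifted index set puts the ultrapower into the universe in which superstability is assumed.
  set U : Ultrafilter (ULift.{u} ℕ) := (hyperfilter ℕ).map ULift.up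
  obtain ⟨m, hm, hlim⟩ := IsMean.exists_ultralimit U (A := fun i f => f i) IsMean.eval
  have hbd : ∀ x : ℕ → ℕ → Y, (∀ n, ∀ i < n, ‖x n i‖ ≤ R) → ∀ i (n : ULift.{u} ℕ),
      ‖if i < n.down then x n.down i else 0‖ ≤ R := by
    intro x hx i n
    split_ifs with hi
    · exact hx _ _ hi
    · simpa using hR
  have hbx := hbd x fun n i hi => (hxy n i hi).1
  have hby := hbd y fun n i hi => (hxy n i hi).2
  set X : ℕ → MeanSpace Y hm := fun i => MeanSpace.mk hm
    (fun n => if i < n.down then x n.down i else 0) ⟨R, fun n => by rw [abs_norm]; exact hbx i n⟩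
  set Z : ℕ → MeanSpace Y hm := fun i => MeanSpace.mk hm
    (fun n => if i < n.down then y n.down i else 0) ⟨R, fun n => by rw [abs_norm]; exact hby i n⟩
  have hst : IsStableSpace (UniformSpace.Completion (MeanSpace Y hm)) :=
    hY _ (isFinitelyRepresentable_completion_meanSpace hm U hlim Y)
  refine hst.not_defect_jump (x := fun i => (X i : UniformSpace.Completion (MeanSpace Y hm)))
    (y := fun i => (Z i : UniformSpace.Completion (MeanSpace Y hm))) (R := R) (σ := σ) hδ
    (fun i => ?_) (fun i => ?_) fun i j k hij hjk => ?_
  · rw [UniformSpace.Completion.norm_coe]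
    exact hm.le_const (X i).isBoundedFun (hbx i)
  · rw [UniformSpace.Completion.norm_coe]
    exact hm.le_const (Z i).isBoundedFun (hby i)
  · have hcoe : ∀ i j, normDefect (X i : UniformSpace.Completion (MeanSpace Y hm)) (Z j) =
        normDefect (X i) (Z j) := fun i j => by
      simp only [normDefect, ← UniformSpace.Completion.coe_sub, UniformSpace.Completion.norm_coe]
    have hdl : ∀ i j, Tendsto (fun n => normDefect ((X i).val n) ((Z j).val n)) U
        (𝓝 (normDefect (X i) (Z j))) := fun i j => by
      rw [MeanSpace.normDefect_eq]
      exact hlim _ (MeanSpace.isBoundedFun_normDefect _ _)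
    rw [hcoe, hcoe]
    refine ge_of_tendsto (((hdl i j).sub (hdl k j)).const_mul σ) ?_
    have hlarge : ∀ᶠ n in (U : Filter (ULift.{u} ℕ)), k < n.down := by
      have h1 : ∀ᶠ n in (hyperfilter ℕ : Filter ℕ), k < n :=
        (eventually_gt_atTop k).filter_mono Nat.hyperfilter_le_atTop
      exact h1
    filter_upwards [hlarge] with n hn
    have h1 := h n.down i j k hij hjk hn
    have hX : ∀ i < n.down, (X i).val n = x n.down i := fun i hi => if_pos hi
    have hZ : ∀ i < n.down, (Z i).val n = y n.down i := fun i hi => if_pos hi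
    rwa [hX i (by omega), hX k hn, hZ j (by omega)]

/-- Deep shattering yields one of two long ladders, separated by the midpoint threshold `δ / 2`. In
one the defect drops by `δ / 2` past the diagonal, in the other it rises, hence the signs `1` and
`-1`. -/
theorem IsSuperstable.exists_not_shatters {Y : Type v} [NormedAddCommGroup Y] [NormedSpace ℝ Y]
    (hY : IsSuperstable.{v, max u v} Y) {δ M : ℝ} (hδ : 0 < δ) :
    ∃ r, ¬ Shatters defectLow (defectHigh δ) r (unitShell Y) {p | ‖p.1‖ ≤ M} := by
  set R := max 2 M
  have hR : 0 ≤ R := le_trans zero_le_two (le_max_left _ _)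
  obtain ⟨n₁, h₁⟩ := IsSuperstable.exists_not_defect_jump.{u, v} hY 1 hR (half_pos hδ)
  obtain ⟨n₂, h₂⟩ := IsSuperstable.exists_not_defect_jump.{u, v} hY (-1) hR (half_pos hδ)
  obtain ⟨K, hK⟩ := exists_ladder_of_shatters (A := Y) (P := Y × ℝ) defectLow (defectHigh δ)
    (defectHigh (δ / 2)) n₁ n₂
  refine ⟨K, fun hs => ?_⟩
  rcases hK _ _ hs with ⟨x, p, hxp, h⟩ | ⟨x, p, hxp, h⟩
  · refine h₁ ⟨x, fun i => (p i).1, fun i hi => ⟨(hxp i hi).1.2.trans (le_max_left _ _),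
      le_trans (hxp i hi).2 (le_max_right _ _)⟩, fun i j k hij hjk hk => ?_⟩
    have a1 : (p j).2 + δ / 2 ≤ normDefect (x i) (p j).1 := (h i (by omega) j (by omega)).1 hij
    have a2 : normDefect (x k) (p j).1 ≤ (p j).2 := (h k hk j (by omega)).2 hjk
    linarith
  · refine h₂ ⟨x, fun i => (p i).1, fun i hi => ⟨(hxp i hi).1.2.trans (le_max_left _ _),
      le_trans (hxp i hi).2 (le_max_right _ _)⟩, fun i j k hij hjk hk => ?_⟩
    have a1 : ¬ (p j).2 + δ / 2 ≤ normDefect (x i) (p j).1 := (h i (by omega) j (by omega)).1 hij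
    have a2 : (p j).2 + δ ≤ normDefect (x k) (p j).1 := (h k hk j (by omega)).2 hjk
    rw [not_le] at a1
    linarith

theorem IsSuperstable.exists_defectBound {Y : Type v} [NormedAddCommGroup Y] [NormedSpace ℝ Y]
    (hY : IsSuperstable.{v, max u v} Y) {η : ℝ} (hη : 0 < η) :
    ∃ N : ℕ, 0 < N ∧ DefectBound Y η N := by
  obtain ⟨r, hr⟩ := IsSuperstable.exists_not_shatters.{u, v} hY (δ := η / 2 / 2) (M := 4 / (η / 2))
    (by positivity)
  obtain ⟨N, hN0, hN⟩ := _root_.exists_defectBound (half_pos hη) hr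
  rw [mul_div_cancel₀ _ two_ne_zero] at hN
  exact ⟨N, hN0, hN⟩

/-! ### Averaging a uniformly continuous map over translations -/

/-- Uniformly continuous maps on normed spaces are bounded at every distance. -/
theorem UniformContinuous.exists_norm_sub_le {X Y : Type*} [NormedAddCommGroup X] [NormedSpace ℝ X]
    [NormedAddCommGroup Y] {f : X → Y} (hf : UniformContinuous f) (R : ℝ) :
    ∃ C, ∀ x y, ‖x - y‖ ≤ R → ‖f x - f y‖ ≤ C := by
  obtain ⟨ρ, hρ, h⟩ := Metric.uniformContinuous_iff.1 hf 1 one_pos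
  obtain ⟨n, hn⟩ := exists_nat_gt (R / ρ)
  refine ⟨n, fun x y hxy => ?_⟩
  have hn' : R < n * ρ := (div_lt_iff₀ hρ).1 hn
  have hn0 : 0 < n := by
    rcases Nat.eq_zero_or_pos n with rfl | h0
    · have := (norm_nonneg _).trans hxy
      simp at hn'
      linarith
    · exact h0
  have hn1 : (0 : ℝ) < n := by exact_mod_cast hn0
  set w := (n : ℝ)⁻¹ • (x - y) with hw
  have hwρ : ‖w‖ < ρ := by
    rw [hw, norm_smul, norm_inv, Real.norm_of_nonneg hn1.le, inv_mul_lt_iff₀ hn1]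
    exact hxy.trans_lt hn'
  have hsum := Finset.sum_range_sub (fun k : ℕ => f (y + (k : ℝ) • w)) n
  have hx : y + (n : ℝ) • w = x := by
    rw [hw, smul_inv_smul₀ hn1.ne', add_sub_cancel]
  simp only [Nat.cast_zero, zero_smul, add_zero, hx] at hsum
  rw [← hsum]
  refine (norm_sum_le_of_le _ fun k _ => ?_).trans_eq (by simp : ∑ k ∈ Finset.range n, (1 : ℝ) = n)
  rw [← dist_eq_norm]
  refine (h ?_).le
  have e : y + ((k + 1 : ℕ) : ℝ) • w - (y + (k : ℝ) • w) = w := by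
    push_cast
    rw [add_smul, one_smul]
    abel
  rwa [dist_eq_norm, e]

/-- A positive exact compression modulus of a uniformly continuous map bounds the map from below on
all pairs of points whose distance is close to `t`. -/
theorem exists_lower_bound_of_almostUncollapsed {X : Type u} {Y : Type v} [NormedAddCommGroup X]
    [NormedSpace ℝ X] [NormedAddCommGroup Y] {f : X → Y} (hf : UniformContinuous f)
    (hf' : IsAlmostUncollapsed f) :
    ∃ t δ ρ : ℝ, 0 < t ∧ 0 < δ ∧ 0 < ρ ∧ ∀ x y, |‖x - y‖ - t| ≤ ρ → δ ≤ ‖f x - f y‖ := by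
  obtain ⟨t, ht, hpos⟩ := hf'
  obtain ⟨c, hc0, hc⟩ := exists_between hpos
  have hctop : c ≠ ⊤ := hc.ne_top
  have hδ : 0 < c.toReal := ENNReal.toReal_pos hc0.ne' hctop
  have hexact : ∀ x y, ‖x - y‖ = t → c.toReal ≤ ‖f x - f y‖ := by
    intro x y hxy
    refine (ENNReal.le_ofReal_iff_toReal_le hctop (norm_nonneg _)).1 (hc.le.trans ?_)
    exact iInf_le_of_le x (iInf_le_of_le y (iInf_le_of_le hxy le_rfl))
  obtain ⟨ρ, hρ, h⟩ := Metric.uniformContinuous_iff.1 hf (c.toReal / 2) (half_pos hδ)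
  refine ⟨t, c.toReal / 2, min (ρ / 2) (t / 2), ht, half_pos hδ, by positivity, fun x y hxy => ?_⟩
  have hxy1 := hxy.trans (min_le_left _ _)
  have hxy2 := hxy.trans (min_le_right _ _)
  have hn : 0 < ‖x - y‖ := by
    rw [abs_le] at hxy2
    linarith
  -- Slide `y` along the line through `x` to distance exactly `t`. This moves it by less than the
  -- modulus of continuity allows.
  set z := x - (t / ‖x - y‖) • (x - y) with hz
  have hxz : ‖x - z‖ = t := by
    rw [hz, sub_sub_cancel, norm_smul, Real.norm_of_nonneg (by positivity)]
    field_simp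
  have hyz : dist y z < ρ := by
    have e : y - z = (t / ‖x - y‖ - 1) • (x - y) := by
      rw [hz, sub_smul, one_smul]
      abel
    have e2 : (t / ‖x - y‖ - 1) * ‖x - y‖ = t - ‖x - y‖ := by field_simp
    rw [dist_eq_norm, e, norm_smul, Real.norm_eq_abs, ← abs_norm (x - y), ← abs_mul, abs_norm, e2,
      abs_sub_comm]
    linarith
  have h1 := h hyz
  rw [dist_eq_norm] at h1
  have h2 := hexact x z hxz
  have h3 : ‖f x - f z‖ ≤ ‖f x - f y‖ + ‖f y - f z‖ := norm_sub_le_norm_sub_add_norm_sub _ _ _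
  linarith

theorem isBoundedFun_translate {X Y : Type*} [NormedAddCommGroup X] [NormedSpace ℝ X]
    [NormedAddCommGroup Y] {f : X → Y} (hf : UniformContinuous f) (x y : X) :
    IsBoundedFun fun z => ‖f (x + z) - f (y + z)‖ := by
  obtain ⟨C, hC⟩ := hf.exists_norm_sub_le ‖x - y‖
  exact ⟨C, fun z => by rw [abs_norm]; exact hC _ _ (by rw [add_sub_add_right_eq_sub])⟩

section Average

variable {X : Type u} [NormedAddCommGroup X] [NormedSpace ℝ X] {Y : Type v} [NormedAddCommGroup Y]
  [NormedSpace ℝ Y] {m : (X → ℝ) → ℝ} {f : X → Y}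

/-- The map that sends `x` to the function `z ↦ f (x + z) - f z`. -/
noncomputable def translateMap (hm : IsMean m) (hf : UniformContinuous f) (x : X) :
    MeanSpace Y hm :=
  MeanSpace.mk hm (fun z => f (x + z) - f z) (by
    obtain ⟨C, hC⟩ := hf.exists_norm_sub_le ‖x‖
    exact ⟨C, fun z => by rw [abs_norm]; exact hC _ _ (by rw [add_sub_cancel_right])⟩)

variable (hm : IsMean m) (hf : UniformContinuous f)

theorem translateMap_sub_val (x y z : X) :
    (translateMap hm hf x - translateMap hm hf y).val z = f (x + z) - f (y + z) :=
  sub_sub_sub_cancel_right _ _ _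

theorem norm_translateMap_sub (x y : X) :
    ‖translateMap hm hf x - translateMap hm hf y‖ = m fun z => ‖f (x + z) - f (y + z)‖ := by
  rw [MeanSpace.norm_eq]
  simp only [translateMap_sub_val]

theorem uniformContinuous_translateMap : UniformContinuous (translateMap hm hf) := by
  rw [Metric.uniformContinuous_iff]
  intro ε hε
  obtain ⟨ρ, hρ, h⟩ := Metric.uniformContinuous_iff.1 hf (ε / 2) (half_pos hε)
  refine ⟨ρ, hρ, fun {x y} hxy => ?_⟩
  rw [dist_eq_norm, norm_translateMap_sub]
  refine (hm.le_const (isBoundedFun_translate hf x y) fun z => ?_).trans_lt (half_lt_self hε)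
  rw [← dist_eq_norm]
  exact (h (by rwa [dist_add_right])).le

theorem norm_translateMap_add (hinv : ∀ h, IsInvariantUnder m h) (x y w : X) :
    ‖translateMap hm hf (x + w) - translateMap hm hf (y + w)‖ =
      ‖translateMap hm hf x - translateMap hm hf y‖ := by
  rw [norm_translateMap_sub, norm_translateMap_sub,
    ← hinv w _ (isBoundedFun_translate hf x y)]
  congr 1
  funext z
  rw [add_assoc, add_assoc, add_comm w z]

/-- By invariance all steps by `w` have the same length, so the triangle inequality suffices. -/
theorem norm_translateMap_nsmul_le (hinv : ∀ h, IsInvariantUnder m h) (x w : X) (n : ℕ) :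
    ‖translateMap hm hf (x + n • w) - translateMap hm hf x‖ ≤
      n * ‖translateMap hm hf (x + w) - translateMap hm hf x‖ := by
  induction n with
  | zero => simp
  | succ n ih =>
    have h1 := norm_translateMap_add hm hf hinv (x + w) x (n • w)
    have e : x + w + n • w = x + (n + 1) • w := by rw [succ_nsmul]; abel
    rw [e] at h1
    have h2 := norm_sub_le_norm_sub_add_norm_sub (translateMap hm hf (x + (n + 1) • w))
      (translateMap hm hf (x + n • w)) (translateMap hm hf x)
    push_cast
    linarith

/-- The averaged translates of `f` have an inverse that is Lipschitz at small distances. -/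
theorem le_norm_translateMap_sub (hinv : ∀ h, IsInvariantUnder m h) {t δ ρ : ℝ} (ht : 0 < t)
    (hρ : 0 < ρ) (hlow : ∀ x y, |‖x - y‖ - t| ≤ ρ → δ ≤ ‖f x - f y‖) {x y : X}
    (hxy : ‖x - y‖ ≤ ρ) :
    δ * ‖x - y‖ ≤ (t + ρ) * ‖translateMap hm hf x - translateMap hm hf y‖ := by
  rcases (norm_nonneg (x - y)).eq_or_lt' with h0 | h0
  · rw [h0, mul_zero]
    positivity
  -- Then `n * ‖x - y‖` overshoots `t` by less than one step, hence by at most `ρ`.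
  set n := ⌈t / ‖x - y‖⌉₊
  have hn1 : t ≤ n * ‖x - y‖ := (div_le_iff₀ h0).1 (Nat.le_ceil _)
  have hn2 : n * ‖x - y‖ < t + ‖x - y‖ := by
    have := Nat.ceil_lt_add_one (show 0 ≤ t / ‖x - y‖ by positivity)
    have h1 := mul_lt_mul_of_pos_right this h0
    rwa [add_mul, one_mul, div_mul_cancel₀ _ h0.ne'] at h1
  have h1 := norm_translateMap_nsmul_le hm hf hinv y (x - y) n
  rw [add_sub_cancel, norm_translateMap_sub hm hf (y + n • (x - y)) y] at h1
  have h2 : δ ≤ m fun z => ‖f (y + n • (x - y) + z) - f (y + z)‖ := by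
    refine hm.const_le (isBoundedFun_translate hf _ _) fun z => hlow _ _ ?_
    have e : y + n • (x - y) + z - (y + z) = (n : ℝ) • (x - y) := by
      rw [Nat.cast_smul_eq_nsmul]
      abel
    rw [e, norm_smul, Real.norm_of_nonneg (Nat.cast_nonneg n), abs_le]
    constructor <;> linarith
  have h3 : 0 ≤ ‖translateMap hm hf x - translateMap hm hf y‖ := norm_nonneg _
  calc δ * ‖x - y‖ ≤ n * ‖translateMap hm hf x - translateMap hm hf y‖ * ‖x - y‖ := by
        gcongr
        exact h2.trans h1
    _ = (n * ‖x - y‖) * ‖translateMap hm hf x - translateMap hm hf y‖ := by ring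
    _ ≤ _ := by
        gcongr
        linarith

end Average

theorem mainTheorem5 {X : Type u} [NormedAddCommGroup X] [NormedSpace ℝ X] [CompleteSpace X]
    {Y : Type v} [NormedAddCommGroup Y] [NormedSpace ℝ Y] [CompleteSpace Y]
    (hY : IsSuperstable.{v, max u v} Y)
    (f : X → Y) (hf : UniformContinuous f) (hf' : IsAlmostUncollapsed f) :
    ∃ (Z : Type (max u v)) (_ : NormedAddCommGroup Z) (_ : NormedSpace ℝ Z)
      (_ : CompleteSpace Z),
      IsSuperstable.{max u v, max u v} Z ∧
      ∃ F : X → Z, UniformContinuous F ∧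
        IsUniformEmbedding (fun x : Metric.closedBall (0 : X) 1 => F x) ∧
        ∃ K : NNReal, AntilipschitzWith K (fun x : Metric.closedBall (0 : X) 1 => F x) := by
  obtain ⟨t, δ, ρ, ht, hδ, hρ, hlow⟩ := exists_lower_bound_of_almostUncollapsed hf hf'
  obtain ⟨m, hm, hinv⟩ := exists_invariant_mean X
  have hρ2 : 0 < ρ / 2 := half_pos hρ
  -- Two points of the unit ball are at distance at most `2`, so scaling by `ρ / 2` brings them
  -- within the range `ρ` of the Lipschitz estimate.
  set F : X → UniformSpace.Completion (MeanSpace Y hm) :=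
    fun x => (translateMap hm hf ((ρ / 2) • x) : MeanSpace Y hm)
  have hF : UniformContinuous F := (UniformSpace.Completion.uniformContinuous_coe _).comp
    ((uniformContinuous_translateMap hm hf).comp (uniformContinuous_const_smul (ρ / 2)))
  have hanti : AntilipschitzWith (Real.toNNReal ((t + ρ) / (δ * (ρ / 2))))
      (fun x : Metric.closedBall (0 : X) 1 => F x) := by
    refine AntilipschitzWith.of_le_mul_dist fun x y => ?_
    have hx := mem_closedBall_zero_iff.1 x.2
    have hy := mem_closedBall_zero_iff.1 y.2
    have hdist : ‖(ρ / 2) • (x : X) - (ρ / 2) • (y : X)‖ = ρ / 2 * ‖(x : X) - y‖ := by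
      rw [← smul_sub, norm_smul, Real.norm_of_nonneg hρ2.le]
    have h1 := le_norm_translateMap_sub hm hf hinv ht hρ hlow
      (x := (ρ / 2) • (x : X)) (y := (ρ / 2) • (y : X)) (by
        rw [hdist]
        have := norm_sub_le (x : X) y
        nlinarith)
    rw [hdist] at h1
    rw [Real.coe_toNNReal _ (by positivity), Subtype.dist_eq, dist_eq_norm, dist_eq_norm,
      ← UniformSpace.Completion.coe_sub, UniformSpace.Completion.norm_coe, div_mul_eq_mul_div,
      le_div_iff₀ (by positivity)]
    linarith
  refine ⟨UniformSpace.Completion (MeanSpace Y hm), inferInstance, inferInstance, inferInstance,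
    isSuperstable_completion_meanSpace hm fun η hη =>
      IsSuperstable.exists_defectBound.{u, v} hY hη, F, hF, ?_, _, hanti⟩
  exact hanti.isUniformEmbedding (hF.comp uniformContinuous_subtype_val)
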